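/- Let $\mathbb K$ be a field of characteristic zero, let $\mathbb K\langle\langle X,Y\rangle\rangle$ be the algebra of formal power series in the non-commuting variables $X,Y$, with $[A,B]=AB-BA$, and let $$\Phi(X,Y)=\log(e^Xe^Y)=\sum_{k\ge 1}\frac{(-1)^{k-1}}{k}\,(e^Xe^Y-1)^k$$ be the Baker–Campbell–Hausdorff series, with homogeneous component $\Phi_m(X,Y)$ of degree $m$. For a permutation $\sigma\in S_{m-1}$ let $d_\sigma=\#\{k\in\{1,\dots,m-2\}:\sigma(k)>\sigma(k+1)\}$ be its number of descents. Then for every $m\ge 2$ $$\Phi_m(X,Y)=\sum_{\substack{i+j=m\\ i,j\ge 1}}\frac{1}{i!}\,\frac{1}{j!}\,\frac1m\sum_{\sigma\in S_{m-1}}\frac{(-1)^{d_\sigma}}{\binom{m-1}{d_\sigma}}\,[X_{\sigma(1)},[X_{\sigma(2)},\cdots,[X_{\sigma(m-1)},Y]\cdots]],$$ where, in the term $(i,j)$, $X_1=\dots=X_i=X$ and $X_{i+1}=\dots=X_{m-1}=Y$. For $m=2,3,4$, collecting terms on the right-hand side, with $[\cdot,\cdot]$ treated as a formal bilinear bracket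 that satisfies no identities (i.e. computing in the free non-associative algebra on $X,Y$), gives $$\tfrac12[X,Y],$$ $$\tfrac1{12}[X,[X,Y]]+\tfrac16[X,[Y,Y]]-\tfrac1{12}[Y,[X,Y]],$$ $$\tfrac1{24}[X,[X,[Y,Y]]]-\tfrac1{24}[X,[Y,[X,Y]]]+\tfrac1{36}[X,[Y,[Y,Y]]]-\tfrac1{36}[Y,[X,[Y,Y]]],$$ respectively. Since $[Y,Y]=0$, these reduce in $\mathbb K\langle\langle X,Y\rangle\rangle$ to $$\Phi_2=\tfrac12[X,Y],\qquad \Phi_3=\tfrac1{12}[X,[X,Y]]-\tfrac1{12}[Y,[X,Y]],\qquad \Phi_4=-\tfrac1{24}[X,[Y,[X,Y]]].$$ -/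

import Mathlib

/-- `K⟨⟨σ⟩⟩`: formal power series over `K` in the non-commuting variables `σ`. A word is a list of
variables, and a series is the family of the coefficients of all words. -/
def NCSeries (σ K : Type*) : Type _ := List σ → K

namespace NCSeries

variable {σ K : Type*}

noncomputable instance [Field K] : AddCommGroup (NCSeries σ K) :=
  inferInstanceAs (AddCommGroup (List σ → K))

noncomputable instance [Field K] : Module K (NCSeries σ K) :=
  inferInstanceAs (Module K (List σ → K))

/-- The coefficient of the word `w` in the series `f`. -/
def coeff (f : NCSeries σ K) (w : List σ) : K := f w

@[ext] theorem ext {f g : NCSeries σ K} (h : ∀ w, f.coeff w = g.coeff w) : f = g := funext h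

section Field

variable [Field K]

@[simp] theorem coeff_add (f g : NCSeries σ K) (w : List σ) :
    (f + g).coeff w = f.coeff w + g.coeff w := rfl

@[simp] theorem coeff_zero (w : List σ) : (0 : NCSeries σ K).coeff w = 0 := rfl

@[simp] theorem coeff_smul (c : K) (f : NCSeries σ K) (w : List σ) :
    (c • f).coeff w = c * f.coeff w := rfl

/-- The series `1`, i.e. the empty word. -/
instance : One (NCSeries σ K) := ⟨fun w => match w with | [] => 1 | _ :: _ => 0⟩

/-- The product of series: the coefficient of `w` in `f * g` is the sum of `f u * g v` over all
ways of writing `w` as a concatenation `u v`. -/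
noncomputable instance : Mul (NCSeries σ K) :=
  ⟨fun f g w => ∑ k ∈ Finset.range (w.length + 1), f (w.take k) * g (w.drop k)⟩

theorem coeff_mul (f g : NCSeries σ K) (w : List σ) :
    (f * g).coeff w =
      ∑ k ∈ Finset.range (w.length + 1), f.coeff (w.take k) * g.coeff (w.drop k) := rfl

@[simp] theorem coeff_one_nil : (1 : NCSeries σ K).coeff [] = 1 := rfl

@[simp] theorem coeff_one_cons (a : σ) (w : List σ) :
    (1 : NCSeries σ K).coeff (a :: w) = 0 := rfl

theorem coeff_one_of_ne_nil {w : List σ} (h : w ≠ []) : (1 : NCSeries σ K).coeff w = 0 := by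
  cases w with
  | nil => exact absurd rfl h
  | cons a w => rfl

@[simp] theorem coeff_mul_nil (f g : NCSeries σ K) :
    (f * g).coeff [] = f.coeff [] * g.coeff [] := by
  simp [coeff_mul]

/-- The series of the coefficients in `f` of the words that start with `a`, with this `a`
removed. -/
def leftQuotient (a : σ) (f : NCSeries σ K) : NCSeries σ K := fun u => f (a :: u)

theorem coeff_mul_cons (f g : NCSeries σ K) (a : σ) (w : List σ) :
    (f * g).coeff (a :: w) = f.coeff [] * g.coeff (a :: w)
      + (leftQuotient a f * g).coeff w := by
  rw [coeff_mul, List.length_cons, Finset.sum_range_succ', add_comm]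
  rfl

protected theorem add_mul' (f g h : NCSeries σ K) : (f + g) * h = f * h + g * h := by
  ext w
  simp [coeff_mul, add_mul, Finset.sum_add_distrib]

protected theorem mul_add' (f g h : NCSeries σ K) : f * (g + h) = f * g + f * h := by
  ext w
  simp [coeff_mul, mul_add, Finset.sum_add_distrib]

protected theorem smul_mul' (c : K) (f g : NCSeries σ K) : (c • f) * g = c • (f * g) := by
  ext w
  simp [coeff_mul, Finset.mul_sum, mul_assoc]

protected theorem mul_smul' (c : K) (f g : NCSeries σ K) : f * (c • g) = c • (f * g) := by
  ext w
  simp [coeff_mul, Finset.mul_sum, mul_left_comm]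

protected theorem zero_mul' (f : NCSeries σ K) : 0 * f = 0 := by
  ext w
  simp [coeff_mul]

protected theorem mul_zero' (f : NCSeries σ K) : f * 0 = 0 := by
  ext w
  simp [coeff_mul]

protected theorem one_mul' (f : NCSeries σ K) : 1 * f = f := by
  ext w
  cases w with
  | nil => simp
  | cons a w =>
    rw [coeff_mul_cons]
    have : leftQuotient a (1 : NCSeries σ K) = 0 := rfl
    rw [this, NCSeries.zero_mul']
    simp

protected theorem mul_one' (f : NCSeries σ K) : f * 1 = f := by
  ext w
  induction w generalizing f with
  | nil => simp
  | cons a w ih =>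
    rw [coeff_mul_cons, ih, coeff_one_cons, mul_zero, zero_add]
    rfl

protected theorem mul_assoc' (f g h : NCSeries σ K) : f * g * h = f * (g * h) := by
  ext w
  induction w generalizing f with
  | nil => simp [mul_assoc]
  | cons a w ih =>
    have key : leftQuotient a (f * g)
        = f.coeff [] • leftQuotient a g + leftQuotient a f * g := by
      ext u
      exact coeff_mul_cons f g a u
    rw [coeff_mul_cons, key, NCSeries.add_mul', coeff_add, ih, NCSeries.smul_mul', coeff_smul,
      coeff_mul_cons f, coeff_mul_cons g, coeff_mul_nil]
    ring

noncomputable instance : Ring (NCSeries σ K) :=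
  { (inferInstance : AddCommGroup (NCSeries σ K)) with
    mul := (· * ·)
    one := 1
    left_distrib := NCSeries.mul_add'
    right_distrib := NCSeries.add_mul'
    zero_mul := NCSeries.zero_mul'
    mul_zero := NCSeries.mul_zero'
    mul_assoc := NCSeries.mul_assoc'
    one_mul := NCSeries.one_mul'
    mul_one := NCSeries.mul_one' }

noncomputable instance : Algebra K (NCSeries σ K) :=
  Algebra.ofModule NCSeries.smul_mul' NCSeries.mul_smul'

/-- The variable `a`, as a series. -/
noncomputable def var [DecidableEq σ] (a : σ) : NCSeries σ K := fun w => if w = [a] then 1 else 0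

/-- If `Z` has no constant term then only words of length at least `k` occur in `Z ^ k`. -/
theorem coeff_pow_eq_zero {Z : NCSeries σ K} (hZ : Z.coeff [] = 0) {k : ℕ} {w : List σ}
    (hw : w.length < k) : (Z ^ k).coeff w = 0 := by
  induction k generalizing w with
  | zero => omega
  | succ k ih =>
    rw [pow_succ', coeff_mul]
    refine Finset.sum_eq_zero fun j hj => ?_
    rcases Nat.eq_zero_or_pos j with rfl | hj0
    · simp [hZ]
    · rcases Nat.eq_zero_or_pos w.length with h0 | h0
      · have : w = [] := List.length_eq_zero_iff.mp h0
        simp [this, hZ]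
      · rw [ih (by rw [List.length_drop]; omega), mul_zero]

/-- The sum `∑_{k ≥ 0} c k • Z ^ k`, for a series `Z` without constant term. By
`coeff_pow_eq_zero`, the powers `Z ^ k` with `k > length w` do not contribute to the coefficient
of `w`. -/
noncomputable def subst (c : ℕ → K) (Z : NCSeries σ K) : NCSeries σ K :=
  fun w => ∑ k ∈ Finset.range (w.length + 1), c k * (Z ^ k).coeff w

/-- `exp Z = ∑_{k ≥ 0} Z ^ k / k!`, for a series `Z` without constant term. -/
noncomputable def exp (Z : NCSeries σ K) : NCSeries σ K :=
  subst (fun k => 1 / (k.factorial : K)) Z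

/-- `log W = ∑_{k ≥ 1} (-1) ^ (k - 1) / k • (W - 1) ^ k`, for a series `W` with constant
term `1`. -/
noncomputable def log (W : NCSeries σ K) : NCSeries σ K :=
  subst (fun k => if k = 0 then 0 else (-1) ^ (k - 1) / (k : K)) (W - 1)

/-- The homogeneous component of degree `m` of a series. -/
def component (m : ℕ) (f : NCSeries σ K) : NCSeries σ K :=
  fun w => if w.length = m then f.coeff w else 0

end Field

end NCSeries

/-- The Baker-Campbell-Hausdorff series `Φ(X, Y) = log (exp X * exp Y)` in `K⟨⟨X, Y⟩⟩`, where
`X` and `Y` are the variables `0` and `1`. -/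
noncomputable def bchSeries (K : Type*) [Field K] : NCSeries (Fin 2) K :=
  NCSeries.log (NCSeries.exp (NCSeries.var 0) * NCSeries.exp (NCSeries.var 1))

/-- `Φ_m(X, Y)`, the homogeneous component of degree `m` of the Baker-Campbell-Hausdorff series. -/
noncomputable def bchTerm (K : Type*) [Field K] (m : ℕ) : NCSeries (Fin 2) K :=
  NCSeries.component m (bchSeries K)

/-- The number `d_σ` of descents of a permutation: the number of positions `k` that are followed
by a position `l = k + 1` with `σ k > σ l`. -/
def numDescents {n : ℕ} (σ : Equiv.Perm (Fin n)) : ℕ :=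
  (Finset.univ.filter fun k : Fin n => ∃ l : Fin n, (l : ℕ) = k + 1 ∧ σ l < σ k).card

/-- The right-nested bracket `[a 0, [a 1, …, [a (n - 1), b] … ]]`, for a bracket operation `br`. -/
def rightNested {A : Type*} (br : A → A → A) {n : ℕ} (a : Fin n → A) (b : A) : A :=
  (List.ofFn a).foldr br b

/-- The expression
`∑_{i + j = m, i ≥ 1, j ≥ 1} 1 / (i! j!) * (1 / m) * ∑_{σ ∈ S_{m - 1}} (-1) ^ d_σ / C(m - 1, d_σ)
  * [X_{σ(1)}, [X_{σ(2)}, …, [X_{σ(m - 1)}, y] … ]]`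
with `X_1 = … = X_i = x` and `X_{i + 1} = … = X_{m - 1} = y`, for a bracket operation `br`.
Positions are counted from `0` here. -/
noncomputable def nestedCommutatorSum (K : Type*) [Field K] {A : Type*} [AddCommGroup A]
    [Module K A] (br : A → A → A) (m : ℕ) (x y : A) : A :=
  ∑ p ∈ (Finset.HasAntidiagonal.antidiagonal m).filter (fun p : ℕ × ℕ => 1 ≤ p.1 ∧ 1 ≤ p.2),
    (1 / (p.1.factorial : K) * (1 / (p.2.factorial : K)) * (1 / (m : K))) •
      ∑ σ : Equiv.Perm (Fin (m - 1)),
        ((-1 : K) ^ numDescents σ / ((m - 1).choose (numDescents σ) : K)) •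
          rightNested br (fun k => if (σ k : ℕ) < p.1 then x else y) y

/-! Write $W=e^Xe^Y$ and $T=W-1$, and let $D$ be the derivation that multiplies a word by its number
of letters $Y$, so that $DW=WY$. On words containing $Y$, $\Phi=\log W$ is recovered from $D\Phi$.

Let a series $F$ act on $Z$ with every variable $a$ acting as $\mathrm{ad}\,a$. This action is
multiplicative in $F$ (`adAct_mul`) and $e^a$ acts as conjugation by $e^a$ (`adAct_exp_var`), so $W$
acts as $Z\mapsto WZW^{-1}$. The key fact is that $D\Phi$ is the action on $Y$ of
$H=\sum_k\frac{(-1)^k}{k+1}WT^k$ (`letterDeriv_bchSeries_sub_mem`). It comes from commuting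
operators: with $q$ = conjugation by $W$ minus the identity, $r$ = right and $p$ = left
multiplication by $T$, one has $1+p=(1+q)(1+r)$, and after multiplication by $q$ the required
identity reads $\log(1+q)-\log(1+p)+\log(1+r)=0$.

Thus $D\Phi$ is a combination of nested commutators ending in $Y$, weighted by the coefficients of
$H$. These are found by polarization. Replace $X,\dots,X,Y,\dots,Y$ by distinct ordered letters and
$W$ by the sum of all strictly increasing words. The coefficient of $T^k$ at a word of distinct
letters counts the cuttings into $k$ increasing pieces: a descent must be cut, an ascent may be. The
alternating sum over $k$ is a beta integral, equal to $(-1)^d/((n+1)\binom nd)$ for $n=m-1$ letters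
with $d$ descents (`sum_coeff_increasing_sub_one_pow`, `coeff_sum_increasing`). Identifying letters
again sums over permutations and divides by factorials (`IsSpecialization.mul`,
`coeff_truncatedLogDeriv`).

Words in $X$ alone are invisible to $D$ and need $\Phi(X,0)=X$ (`coeff_bchSeries_replicate_zero`).
Infinite sums are handled throughout by truncation modulo series of order at least $n$. -/

namespace NCSeries

/-! ### The order filtration and truncation of substituted series. -/

section Order

variable {σ K : Type*} [Field K]

@[simp] theorem coeff_sub (f g : NCSeries σ K) (w : List σ) :
    (f - g).coeff w = f.coeff w - g.coeff w := rfl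

/-- Taking the coefficient of a word, as a linear map. -/
def coeffHom (w : List σ) : NCSeries σ K →ₗ[K] K where
  toFun f := f.coeff w
  map_add' _ _ := rfl
  map_smul' _ _ := rfl

theorem coeff_sum {ι : Type*} (s : Finset ι) (f : ι → NCSeries σ K) (w : List σ) :
    (∑ i ∈ s, f i).coeff w = ∑ i ∈ s, (f i).coeff w :=
  map_sum (coeffHom w) f s

variable (σ K) in
/-- The series in which only words of length at least `n` occur. -/
def orderGE (n : ℕ) : Submodule K (NCSeries σ K) where
  carrier := {f | ∀ w : List σ, w.length < n → f.coeff w = 0}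
  add_mem' hf hg w hw := by rw [coeff_add, hf w hw, hg w hw, add_zero]
  zero_mem' _ _ := rfl
  smul_mem' c f hf w hw := by rw [coeff_smul, hf w hw, mul_zero]

theorem mem_orderGE_zero (f : NCSeries σ K) : f ∈ orderGE σ K 0 := fun _ h => by omega

theorem mem_orderGE_one {f : NCSeries σ K} : f ∈ orderGE σ K 1 ↔ f.coeff [] = 0 := by
  refine ⟨fun h => h [] (by simp), fun h w hw => ?_⟩
  rw [List.length_eq_zero_iff.mp (by omega : w.length = 0), h]

theorem orderGE_anti {m n : ℕ} (h : m ≤ n) : orderGE σ K n ≤ orderGE σ K m :=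
  fun _ hf w hw => hf w (by omega)

theorem eq_zero_of_mem_orderGE {f : NCSeries σ K} (h : ∀ n, f ∈ orderGE σ K n) : f = 0 :=
  ext fun w => h (w.length + 1) w (by omega)

theorem coeff_eq_of_sub_mem {n : ℕ} {f g : NCSeries σ K} (h : f - g ∈ orderGE σ K n) {w : List σ}
    (hw : w.length < n) : f.coeff w = g.coeff w :=
  sub_eq_zero.mp (h w hw)

theorem mul_mem_orderGE {m n : ℕ} {f g : NCSeries σ K} (hf : f ∈ orderGE σ K m)
    (hg : g ∈ orderGE σ K n) : f * g ∈ orderGE σ K (m + n) := by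
  intro w hw
  rw [coeff_mul]
  refine Finset.sum_eq_zero fun k hk => ?_
  rw [Finset.mem_range] at hk
  by_cases h : k < m
  · rw [hf _ (by rw [List.length_take]; omega), zero_mul]
  · rw [hg _ (by rw [List.length_drop]; omega), mul_zero]

theorem mul_mem_orderGE_left {n : ℕ} (f : NCSeries σ K) {g : NCSeries σ K}
    (hg : g ∈ orderGE σ K n) : f * g ∈ orderGE σ K n := by
  simpa using mul_mem_orderGE (mem_orderGE_zero f) hg

theorem mul_mem_orderGE_right {n : ℕ} {f : NCSeries σ K} (g : NCSeries σ K)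
    (hf : f ∈ orderGE σ K n) : f * g ∈ orderGE σ K n := by
  simpa using mul_mem_orderGE hf (mem_orderGE_zero g)

/-- The commutator with `f`, as a linear map. -/
noncomputable def ad (f : NCSeries σ K) : NCSeries σ K →ₗ[K] NCSeries σ K :=
  LinearMap.mulLeft K f - LinearMap.mulRight K f

theorem ad_apply (f g : NCSeries σ K) : ad f g = f * g - g * f := rfl

theorem lie_eq_ad (f g : NCSeries σ K) : ⁅f, g⁆ = ad f g := rfl

theorem ad_mem_orderGE {m n : ℕ} {f g : NCSeries σ K} (hf : f ∈ orderGE σ K m)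
    (hg : g ∈ orderGE σ K n) : ad f g ∈ orderGE σ K (m + n) := by
  rw [ad_apply]
  exact sub_mem (mul_mem_orderGE hf hg) (add_comm m n ▸ mul_mem_orderGE hg hf)

theorem pow_mem_orderGE {f : NCSeries σ K} (hf : f ∈ orderGE σ K 1) (k : ℕ) :
    f ^ k ∈ orderGE σ K k :=
  fun _ hw => coeff_pow_eq_zero (mem_orderGE_one.mp hf) hw

/-- The omitted powers $Z^k$, $k\ge n$, start in degree $n$. This replaces exponentials and
logarithms by polynomials in $Z$. -/
theorem subst_sub_sum_mem (c : ℕ → K) {Z : NCSeries σ K} (hZ : Z ∈ orderGE σ K 1) (n : ℕ) :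
    subst c Z - ∑ k ∈ Finset.range n, c k • Z ^ k ∈ orderGE σ K n := by
  intro w hw
  rw [coeff_sub, coeff_sum, sub_eq_zero]
  refine Finset.sum_subset (Finset.range_mono (by omega)) fun k _ hk => ?_
  rw [Finset.mem_range] at hk
  exact mul_eq_zero_of_right _ (pow_mem_orderGE hZ k w (by omega))

theorem leftQuotient_add (a : σ) (f g : NCSeries σ K) :
    leftQuotient a (f + g) = leftQuotient a f + leftQuotient a g := rfl

theorem leftQuotient_smul (a : σ) (c : K) (f : NCSeries σ K) :
    leftQuotient a (c • f) = c • leftQuotient a f := rfl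

theorem leftQuotient_mul (a : σ) (f g : NCSeries σ K) :
    leftQuotient a (f * g) = f.coeff [] • leftQuotient a g + leftQuotient a f * g :=
  ext fun u => coeff_mul_cons f g a u

@[simp] theorem leftQuotient_one (a : σ) : leftQuotient a (1 : NCSeries σ K) = 0 := rfl

@[simp] theorem coeff_exp_nil (Z : NCSeries σ K) : (exp Z).coeff [] = 1 := by
  change ∑ k ∈ Finset.range 1, _ = _
  simp

theorem exp_sub_sum_mem {Z : NCSeries σ K} (hZ : Z ∈ orderGE σ K 1) (n : ℕ) :
    exp Z - ∑ k ∈ Finset.range n, (1 / (k.factorial : K)) • Z ^ k ∈ orderGE σ K n :=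
  subst_sub_sum_mem _ hZ n

theorem subst_commute (c d : ℕ → K) {Z Z' : NCSeries σ K} (hZ : Z ∈ orderGE σ K 1)
    (hZ' : Z' ∈ orderGE σ K 1) (h : Commute Z Z') : Commute (subst c Z) (subst d Z') := by
  rw [commute_iff_eq, ← sub_eq_zero]
  refine eq_zero_of_mem_orderGE fun n => ?_
  have h1 := subst_sub_sum_mem c hZ n
  have h2 := subst_sub_sum_mem d hZ' n
  set E := ∑ k ∈ Finset.range n, c k • Z ^ k
  set E' := ∑ k ∈ Finset.range n, d k • Z' ^ k
  have h3 : E * E' = E' * E :=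
    Commute.sum_left _ _ _ fun i _ => Commute.sum_right _ _ _ fun j _ =>
      ((h.pow_pow i j).smul_left _).smul_right _
  have h4 := add_mem (mul_mem_orderGE_right (subst d Z') h1) (mul_mem_orderGE_left E h2)
  have h5 := add_mem (mul_mem_orderGE_left (subst d Z') h1) (mul_mem_orderGE_right E h2)
  convert sub_mem h4 h5 using 1
  simp only [mul_sub, sub_mul, h3]
  abel

end Order

/-! ### Powers of a single variable. -/

section Var

variable {σ K : Type*} [Field K] [DecidableEq σ]

theorem coeff_var (a : σ) (w : List σ) :
    (var a : NCSeries σ K).coeff w = if w = [a] then 1 else 0 := rfl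

theorem var_mem_orderGE (a : σ) : (var a : NCSeries σ K) ∈ orderGE σ K 1 :=
  mem_orderGE_one.mpr (by simp [coeff_var])

@[simp] theorem leftQuotient_var (a b : σ) :
    leftQuotient a (var b : NCSeries σ K) = if a = b then 1 else 0 := by
  ext w
  change (if a :: w = [b] then (1 : K) else 0) = _
  by_cases h : a = b
  · cases w <;> simp [h]
  · simp [h]

theorem coeff_var_pow (a : σ) (k : ℕ) (w : List σ) :
    ((var a : NCSeries σ K) ^ k).coeff w = if w = List.replicate k a then 1 else 0 := by
  induction k generalizing w with
  | zero =>
    cases w <;> simp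
  | succ k ih =>
    rw [pow_succ']
    cases w with
    | nil =>
      simp [List.replicate_succ, mem_orderGE_one.mp (var_mem_orderGE (K := K) a)]
    | cons b w =>
      rw [coeff_mul_cons, mem_orderGE_one.mp (var_mem_orderGE (K := K) a), zero_mul, zero_add,
        leftQuotient_var, List.replicate_succ]
      by_cases h : b = a
      · simp [h, ih]
      · simp [h]

end Var

/-! ### The adjoint action of series; exponentials act by conjugation. -/

section AdAct

variable {σ K : Type*} [Field K] [DecidableEq σ] [Fintype σ]

/-- The sum over the words `a₁ ⋯ aₙ` of length `n` of the series
`F(a₁ ⋯ aₙ) • [a₁, [a₂, …, [aₙ, Z] … ]]`. -/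
noncomputable def adSum : ℕ → NCSeries σ K → NCSeries σ K → NCSeries σ K
  | 0, F, Z => F.coeff [] • Z
  | n + 1, F, Z => ∑ a, ad (var a) (adSum n (leftQuotient a F) Z)

theorem adSum_add (n : ℕ) (F G Z : NCSeries σ K) :
    adSum n (F + G) Z = adSum n F Z + adSum n G Z := by
  induction n generalizing F G with
  | zero => simp [adSum, add_smul]
  | succ n ih => simp [adSum, leftQuotient_add, ih, Finset.sum_add_distrib]

theorem adSum_smul (n : ℕ) (c : K) (F Z : NCSeries σ K) :
    adSum n (c • F) Z = c • adSum n F Z := by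
  induction n generalizing F with
  | zero => simp [adSum, mul_smul]
  | succ n ih => simp [adSum, leftQuotient_smul, ih, Finset.smul_sum]

theorem adSum_mem_orderGE (n : ℕ) (F Z : NCSeries σ K) : adSum n F Z ∈ orderGE σ K n := by
  induction n generalizing F with
  | zero => exact mem_orderGE_zero _
  | succ n ih =>
    exact sum_mem fun a _ => add_comm 1 n ▸ ad_mem_orderGE (var_mem_orderGE a) (ih _)

theorem adSum_eq_zero_of_mem_orderGE {m n : ℕ} (h : n < m) {F : NCSeries σ K}
    (hF : F ∈ orderGE σ K m) (Z : NCSeries σ K) : adSum n F Z = 0 := by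
  induction n generalizing F m with
  | zero => simp [adSum, hF [] h]
  | succ n ih =>
    refine Finset.sum_eq_zero fun a _ => ?_
    rw [ih (m := m - 1) (F := leftQuotient a F) (by omega)
      fun w hw => hF (a :: w) (by rw [List.length_cons]; omega), map_zero]

theorem adSum_eq_sum (n : ℕ) (F Z : NCSeries σ K) :
    adSum n F Z = ∑ u : Fin n → σ, F.coeff (List.ofFn u) •
      rightNested (fun f g => ⁅f, g⁆) (fun k => (var (u k) : NCSeries σ K)) Z := by
  induction n generalizing F with
  | zero => simp [adSum, rightNested]
  | succ n ih =>
    rw [← (Fin.consEquiv fun _ => σ).sum_comp, Fintype.sum_prod_type, adSum]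
    refine Finset.sum_congr rfl fun a _ => ?_
    rw [ih, map_sum]
    refine Finset.sum_congr rfl fun u _ => ?_
    simp only [Fin.consEquiv_apply, rightNested, List.ofFn_succ, Fin.cons_zero, Fin.cons_succ,
      List.foldr_cons]
    rw [map_smul, lie_eq_ad]
    rfl

/-- The action of a series `F` on `Z`, with every variable `a` acting as `ad a`:
the sum over all words `a₁ ⋯ aₙ` of `F(a₁ ⋯ aₙ) • [a₁, [a₂, …, [aₙ, Z] … ]]`. -/
noncomputable def adAct (Z : NCSeries σ K) : NCSeries σ K →ₗ[K] NCSeries σ K where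
  toFun F w := ∑ n ∈ Finset.range (w.length + 1), (adSum n F Z).coeff w
  map_add' F G := by
    ext w
    exact (Finset.sum_congr rfl fun n _ => by rw [adSum_add, coeff_add]).trans
      Finset.sum_add_distrib
  map_smul' c F := by
    ext w
    exact (Finset.sum_congr rfl fun n _ => (by rw [adSum_smul, coeff_smul] :
      _ = c * (adSum n F Z).coeff w)).trans (Finset.mul_sum _ _ c).symm

theorem coeff_adAct (Z F : NCSeries σ K) (w : List σ) :
    (adAct Z F).coeff w = ∑ n ∈ Finset.range (w.length + 1), (adSum n F Z).coeff w := rfl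

theorem adAct_sub_sum_mem (Z F : NCSeries σ K) (m : ℕ) :
    adAct Z F - ∑ n ∈ Finset.range m, adSum n F Z ∈ orderGE σ K m := by
  intro w hw
  rw [coeff_sub, coeff_sum, sub_eq_zero]
  refine Finset.sum_subset (Finset.range_mono (by omega)) fun k _ hk => ?_
  rw [Finset.mem_range] at hk
  exact adSum_mem_orderGE k F Z w (by omega)

theorem adAct_mem_orderGE {m : ℕ} {F : NCSeries σ K} (hF : F ∈ orderGE σ K m)
    (Z : NCSeries σ K) : adAct Z F ∈ orderGE σ K m := by
  intro w hw
  rw [coeff_adAct]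
  refine Finset.sum_eq_zero fun n hn => ?_
  rw [Finset.mem_range] at hn
  rw [adSum_eq_zero_of_mem_orderGE (by omega) hF, coeff_zero]

/-- The first letter of each word of $F$ is the outermost bracket. This recursion replaces the
definition of the action in the proofs of its algebraic properties. -/
theorem adAct_eq (Z F : NCSeries σ K) :
    adAct Z F = F.coeff [] • Z + ∑ a, ad (var a) (adAct Z (leftQuotient a F)) := by
  rw [← sub_eq_zero]
  refine eq_zero_of_mem_orderGE fun m => ?_
  have h1 := orderGE_anti (Nat.le_succ m) (adAct_sub_sum_mem Z F (m + 1))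
  have h2 : ∑ a, ad (var a) (adAct Z (leftQuotient a F)
      - ∑ n ∈ Finset.range m, adSum n (leftQuotient a F) Z) ∈ orderGE σ K m :=
    sum_mem fun a _ => orderGE_anti (by omega)
      (ad_mem_orderGE (var_mem_orderGE a) (adAct_sub_sum_mem Z (leftQuotient a F) m))
  convert sub_mem h1 h2 using 1
  rw [Finset.sum_range_succ']
  simp only [adSum, map_sub, map_sum, Finset.sum_sub_distrib]
  rw [Finset.sum_comm]
  abel

/-- Each unfolding of the recursion gains one order. Hence two expressions in $F$ satisfying the
recursion of `adAct_eq` with the same constant contribution agree. -/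
theorem eq_zero_of_eq_sum_ad (D : NCSeries σ K → NCSeries σ K)
    (hD : ∀ F, D F = ∑ a, ad (var a) (D (leftQuotient a F))) (F : NCSeries σ K) : D F = 0 := by
  refine eq_zero_of_mem_orderGE fun m => ?_
  induction m generalizing F with
  | zero => exact mem_orderGE_zero _
  | succ m ih =>
    rw [hD]
    exact sum_mem fun a _ => add_comm 1 m ▸ ad_mem_orderGE (var_mem_orderGE a) (ih _)

/-- As functions of $F$, both sides satisfy the recursion of `adAct_eq` with the same constant
contribution. -/
theorem adAct_mul (Z F G : NCSeries σ K) : adAct Z (F * G) = adAct (adAct Z G) F := by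
  rw [← sub_eq_zero]
  refine eq_zero_of_eq_sum_ad (fun F => adAct Z (F * G) - adAct (adAct Z G) F) (fun F => ?_) F
  rw [adAct_eq Z (F * G), adAct_eq (adAct Z G) F, adAct_eq Z G]
  simp only [leftQuotient_mul, map_add, map_sub, map_smul, Finset.sum_sub_distrib,
    Finset.sum_add_distrib, coeff_mul_nil, smul_add, mul_smul, Finset.smul_sum]
  rw [← adAct_eq Z G]
  abel

@[simp] theorem adAct_one (Z : NCSeries σ K) : adAct Z 1 = Z := by
  rw [adAct_eq]
  simp

@[simp] theorem adAct_var (Z : NCSeries σ K) (a : σ) : adAct Z (var a) = ad (var a) Z := by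
  rw [adAct_eq, mem_orderGE_one.mp (var_mem_orderGE a), zero_smul, zero_add,
    Finset.sum_eq_single a]
  · simp
  · intro b _ hb
    simp [hb]
  · simp

/-- Every commutator with $1$ vanishes. Compared with the conjugation formula, this yields
$e^ae^{-a}=1$. -/
theorem adAct_one_left (F : NCSeries σ K) : adAct 1 F = F.coeff [] • 1 := by
  rw [← sub_eq_zero]
  refine eq_zero_of_eq_sum_ad (fun F => adAct 1 F - F.coeff [] • 1) (fun F => ?_) F
  rw [adAct_eq, add_sub_cancel_left]
  refine Finset.sum_congr rfl fun a _ => ?_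
  rw [map_sub, map_smul, ad_apply _ 1]
  simp

variable [CharZero K]

/-- The operator $\mathrm{ad}\,a$ is the sum of left multiplication by $a$ and right multiplication
by $-a$; these commute, so the binomial theorem applies. -/
theorem adAct_pow_var (Z : NCSeries σ K) (a : σ) (k : ℕ) :
    (1 / (k.factorial : K)) • adAct Z (var a ^ k) =
      ∑ p ∈ Finset.HasAntidiagonal.antidiagonal k, (1 / (p.1.factorial : K) * (1 / (p.2.factorial : K))) •
        (var a ^ p.1 * Z * (-var a) ^ p.2) := by
  have h : ∀ k, adAct Z (var a ^ k) =
      ((LinearMap.mulLeft K (var a : NCSeries σ K) + LinearMap.mulRight K (-var a : NCSeries σ K)) ^ k) Z := by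
    intro k
    induction k with
    | zero => simp
    | succ k ih =>
      rw [pow_succ', adAct_mul, adAct_var, ih, pow_succ', Module.End.mul_apply,
        LinearMap.add_apply, LinearMap.mulLeft_apply, LinearMap.mulRight_apply, ad_apply]
      rw [mul_neg, sub_eq_add_neg]
  rw [h, (LinearMap.commute_mulLeft_right (R := K) (var a : NCSeries σ K) (-var a)).add_pow', LinearMap.sum_apply, Finset.smul_sum]
  refine Finset.sum_congr rfl fun p hp => ?_
  have hp' := Finset.HasAntidiagonal.mem_antidiagonal.mp hp
  rw [LinearMap.smul_apply, Module.End.mul_apply, LinearMap.pow_mulLeft, LinearMap.pow_mulRight,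
    LinearMap.mulLeft_apply, LinearMap.mulRight_apply, ← Nat.cast_smul_eq_nsmul K, smul_smul,
    mul_assoc]
  congr 1
  subst hp'
  have h1 : (p.1 + p.2).choose p.1 * p.1.factorial * p.2.factorial = (p.1 + p.2).factorial := by
    simpa using Nat.choose_mul_factorial_mul_factorial (Nat.le_add_right p.1 p.2)
  rw [← h1]
  have h2 := Nat.cast_ne_zero (R := K).mpr (Nat.choose_pos (Nat.le_add_right p.1 p.2)).ne'
  push_cast
  field_simp

theorem adAct_exp_var (Z : NCSeries σ K) (a : σ) :
    adAct Z (exp (var a)) = exp (var a) * Z * exp (-var a) := by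
  rw [← sub_eq_zero]
  refine eq_zero_of_mem_orderGE fun m => ?_
  have hv : (var a : NCSeries σ K) ∈ orderGE σ K 1 := var_mem_orderGE a
  have h1 := subst_sub_sum_mem (fun k => 1 / (k.factorial : K)) hv m
  have h2 := subst_sub_sum_mem (fun k => 1 / (k.factorial : K)) (neg_mem hv) m
  set E : NCSeries σ K := ∑ k ∈ Finset.range m, (1 / (k.factorial : K)) • var a ^ k with hE
  set E' : NCSeries σ K := ∑ k ∈ Finset.range m, (1 / (k.factorial : K)) • (-var a) ^ k with hE'
  have h3 : adAct Z E - E * Z * E' ∈ orderGE σ K m := by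
    have e1 : adAct Z E = ∑ p ∈ Finset.range m ×ˢ Finset.range m with p.1 + p.2 < m,
        (1 / (p.1.factorial : K) * (1 / (p.2.factorial : K))) •
        (var a ^ p.1 * Z * (-var a) ^ p.2) := by
      rw [hE, map_sum]
      simp only [map_smul, adAct_pow_var]
      rw [Finset.sum_sigma']
      refine Finset.sum_nbij' (fun x => x.2) (fun p => ⟨p.1 + p.2, p⟩) ?_ ?_ ?_ ?_ ?_
      · rintro ⟨n, p⟩ h
        simp only [Finset.mem_sigma, Finset.mem_range, Finset.HasAntidiagonal.mem_antidiagonal] at h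
        simp only [Finset.mem_filter, Finset.mem_product, Finset.mem_range]
        omega
      · rintro p h
        simp only [Finset.mem_filter, Finset.mem_product, Finset.mem_range] at h
        simp only [Finset.mem_sigma, Finset.mem_range, Finset.HasAntidiagonal.mem_antidiagonal]
        exact ⟨h.2, trivial⟩
      · rintro ⟨n, p⟩ h
        simp only [Finset.mem_sigma, Finset.mem_range, Finset.HasAntidiagonal.mem_antidiagonal] at h
        obtain ⟨_, rfl⟩ := h
        rfl
      · intro p _
        rfl
      · intro p _
        rfl
    have e2 : E * Z * E' = ∑ p ∈ Finset.range m ×ˢ Finset.range m,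
        (1 / (p.1.factorial : K) * (1 / (p.2.factorial : K))) •
        (var a ^ p.1 * Z * (-var a) ^ p.2) := by
      rw [hE, hE', Finset.sum_mul, Finset.sum_mul_sum, Finset.sum_product]
      simp only [smul_mul_assoc, mul_smul_comm, smul_smul]
      refine Finset.sum_congr rfl fun i _ => Finset.sum_congr rfl fun j _ => ?_
      rw [mul_comm]
    -- The product of the truncations runs over a square of exponents, the action over the triangle
    -- of exponent sum below `m`; the surplus terms have order at least `m`.
    rw [e1, e2, ← Finset.sum_filter_add_sum_filter_not (Finset.range m ×ˢ Finset.range m) (fun p : ℕ × ℕ => p.1 + p.2 < m)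
      (f := fun p => (1 / (p.1.factorial : K) * (1 / (p.2.factorial : K))) •
        (var a ^ p.1 * Z * (-var a) ^ p.2)), sub_add_cancel_left]
    refine neg_mem (sum_mem fun p hp => Submodule.smul_mem _ _ ?_)
    rw [Finset.mem_filter] at hp
    refine orderGE_anti (not_lt.mp hp.2) (mul_mem_orderGE (mul_mem_orderGE_right _ ?_) ?_)
    · exact pow_mem_orderGE hv _
    · exact pow_mem_orderGE (neg_mem hv) _
  have h4 := adAct_mem_orderGE h1 Z
  rw [map_sub] at h4
  have h5 := mul_mem_orderGE_right (exp (-var a)) (mul_mem_orderGE_right Z h1)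
  have h6 := mul_mem_orderGE_left (E * Z) h2
  convert sub_mem (add_mem h3 h4) (add_mem h5 h6) using 1
  simp only [exp, sub_mul, mul_sub]
  abel

theorem exp_var_mul_exp_neg (a : σ) : exp (var a) * exp (-var a) = (1 : NCSeries σ K) := by
  have := adAct_exp_var (1 : NCSeries σ K) a
  rwa [adAct_one_left, coeff_exp_nil, one_smul, mul_one, eq_comm] at this

end AdAct

end NCSeries

/-! ### The functional equation of the logarithm in two commuting variables. -/

section LogIdentity

open PowerSeries in
/-- The functional equation of the logarithm for the factors `1 + q t` and `1 + r t`, with the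
logarithm series truncated. -/
theorem coeff_truncated_log_eq_zero (K : Type*) {R : Type*} [Field K] [CharZero K] [CommRing R]
    [IsDomain R] [CharZero R] [Algebra K R] (q r : R) {n j : ℕ} (hj : j ≤ n) :
    coeff j (∑ k ∈ Finset.range n, ((-1) ^ k / ((k : K) + 1)) •
      ((C q * X) ^ (k + 1) - (C q * X + C r * X + C q * X * (C r * X)) ^ (k + 1)
        + (C r * X) ^ (k + 1) : R⟦X⟧)) = 0 := by
  set z₁ : R⟦X⟧ := C q * X with h1
  set z₂ : R⟦X⟧ := C r * X with h2
  set z₃ : R⟦X⟧ := z₁ + z₂ + z₁ * z₂ with h3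
  set D : R⟦X⟧ := ∑ k ∈ Finset.range n, ((-1) ^ k / ((k : K) + 1)) •
    (z₁ ^ (k + 1) - z₃ ^ (k + 1) + z₂ ^ (k + 1)) with hD
  have d1 : X ∣ z₁ := dvd_mul_left _ _
  have d2 : X ∣ z₂ := dvd_mul_left _ _
  have d3 : X ∣ z₃ := dvd_add (dvd_add d1 d2) (d1.mul_right _)
  have hz : ∀ (k : ℕ) (z : R⟦X⟧), ((-1) ^ k / ((k : K) + 1)) • d⁄dX R (z ^ (k + 1)) =
      (-z) ^ k * d⁄dX R z := by
    intro k z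
    have hk : (k : K) + 1 ≠ 0 := by exact_mod_cast Nat.succ_ne_zero k
    rw [Derivation.leibniz_pow, ← Nat.cast_smul_eq_nsmul K, smul_smul, Nat.cast_succ,
      div_mul_cancel₀ _ hk, Nat.add_sub_cancel, smul_eq_mul, neg_pow z, mul_assoc]
    rcases Nat.even_or_odd k with h | h <;> simp [h.neg_one_pow]
  have hgeom : ∀ z : R⟦X⟧, (1 + z) * ∑ k ∈ Finset.range n, (-z) ^ k = 1 - (-z) ^ n := by
    intro z
    simpa using mul_neg_geom_sum (-z) n
  have hD' : d⁄dX R D = (∑ k ∈ Finset.range n, (-z₁) ^ k) * d⁄dX R z₁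
      - (∑ k ∈ Finset.range n, (-z₃) ^ k) * d⁄dX R z₃
      + (∑ k ∈ Finset.range n, (-z₂) ^ k) * d⁄dX R z₂ := by
    rw [hD, map_sum, Finset.sum_mul, Finset.sum_mul, Finset.sum_mul, ← Finset.sum_sub_distrib,
      ← Finset.sum_add_distrib]
    refine Finset.sum_congr rfl fun k _ => ?_
    rw [← hz, ← hz, ← hz, ← smul_sub, ← smul_add, ← map_sub, ← map_add]
    exact (d⁄dX R).toLinearMap.map_smul_of_tower _ _
  have hz3 : d⁄dX R z₃ = d⁄dX R z₁ * (1 + z₂) + (1 + z₁) * d⁄dX R z₂ := by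
    rw [h3, map_add, map_add, Derivation.leibniz _ z₁ z₂, smul_eq_mul, smul_eq_mul]
    ring
  -- Multiplying by $(1+z_1)(1+z_2)=1+z_3$ clears the denominators of all three geometric series,
  -- and only their tails, divisible by `X ^ n`, remain.
  have hkey : (1 + z₁) * (1 + z₂) * d⁄dX R D = (-z₃) ^ n * d⁄dX R z₃
      - (-z₁) ^ n * ((1 + z₂) * d⁄dX R z₁) - (-z₂) ^ n * ((1 + z₁) * d⁄dX R z₂) := by
    have e : (1 + z₁) * (1 + z₂) = 1 + z₃ := by rw [h3]; ring
    rw [hD', mul_add, mul_sub, e, ← mul_assoc (1 + z₃) _ (d⁄dX R z₃), hgeom z₃, ← e]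
    have e1 := hgeom z₁
    have e2 := hgeom z₂
    rw [hz3]
    linear_combination (1 + z₂) * d⁄dX R z₁ * e1 + (1 + z₁) * d⁄dX R z₂ * e2
  have hu : IsUnit ((1 + z₁) * (1 + z₂)) := by
    rw [isUnit_iff_constantCoeff]
    simp [h1, h2]
  have hdvd : X ^ n ∣ d⁄dX R D := by
    rw [← hu.dvd_mul_left, hkey]
    have hp : ∀ z : R⟦X⟧, X ∣ z → X ^ n ∣ (-z) ^ n :=
      fun z hz => pow_dvd_pow_of_dvd ((dvd_neg).mpr hz) n
    exact dvd_sub (dvd_sub ((hp _ d3).mul_right _) ((hp _ d1).mul_right _))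
      ((hp _ d2).mul_right _)
  rw [X_pow_dvd_iff] at hdvd
  -- The derivative does not see the constant coefficient, which vanishes since every $z_i$ is
  -- divisible by `X`.
  rcases j with _ | j
  · rw [hD, map_sum]
    refine Finset.sum_eq_zero fun k _ => ?_
    rw [← algebraMap_smul R, coeff_smul]
    simp [h1, h2, h3]
  · have := hdvd j (by omega)
    rw [coeff_derivative] at this
    exact (mul_eq_zero.mp this).resolve_right (by exact_mod_cast Nat.succ_ne_zero j)

open PowerSeries in
-- The substitution $X_i\mapsto X_it$ makes the degree in $t$ record the total degree, which
-- transfers the power series identity to polynomials.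
theorem coeff_aeval_C_mul_X {σ K : Type*} [Field K] (p : MvPolynomial σ K) (j : ℕ) :
    coeff j (MvPolynomial.aeval (fun i => C (MvPolynomial.X i) * X :
      σ → (MvPolynomial σ K)⟦X⟧) p) = MvPolynomial.homogeneousComponent j p := by
  classical
  induction p using MvPolynomial.induction_on' with
  | monomial d c =>
    have : (d.prod fun i k => (C (MvPolynomial.X i) * X : (MvPolynomial σ K)⟦X⟧) ^ k) =
        C (MvPolynomial.monomial d 1) * X ^ d.degree := by
      rw [MvPolynomial.monomial_eq, map_one, one_mul, Finsupp.prod, Finsupp.prod, map_prod,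
        Finsupp.degree_apply, ← Finset.prod_pow_eq_pow_sum, ← Finset.prod_mul_distrib]
      exact Finset.prod_congr rfl fun i _ => by rw [mul_pow, map_pow]
    rw [MvPolynomial.aeval_monomial, this, ← Algebra.smul_def, ← algebraMap_smul (MvPolynomial σ K),
      coeff_smul, coeff_C_mul, coeff_X_pow]
    ext e
    rw [MvPolynomial.coeff_homogeneousComponent, MvPolynomial.algebraMap_eq]
    split_ifs with h h' h'
    · simp [MvPolynomial.coeff_monomial]
    · rw [mul_one, smul_eq_mul, MvPolynomial.C_mul_monomial, MvPolynomial.coeff_monomial, if_neg]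
      rintro rfl
      exact h' h.symm
    · rw [MvPolynomial.coeff_monomial, if_neg]
      · simp
      rintro rfl
      exact h h'.symm
    · simp
  | add p q hp hq => rw [map_add, map_add, hp, hq, map_add]

open MvPolynomial in
-- With $q,r$ the variables and $p=q+r+qr$, one has $q(1+r)=p-r$. Multiplying by $q$ therefore
-- telescopes the inner sum and leaves the truncation of $\log(1+q)-\log(1+p)+\log(1+r)$; then $q$
-- is cancelled.
theorem homogeneousComponent_truncated_log_eq_zero (K : Type*) [Field K] [CharZero K] {n j : ℕ}
    (hj : j < n) :
    homogeneousComponent j (∑ k ∈ Finset.range n, ((-1) ^ k / ((k : K) + 1)) •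
      ((X 0 : MvPolynomial (Fin 2) K) ^ k - (∑ i ∈ Finset.range (k + 1),
        (X 0 + X 1 + X 0 * X 1) ^ i * X 1 ^ (k - i)) * (1 + X 1))) = 0 := by
  set E := ∑ k ∈ Finset.range n, ((-1) ^ k / ((k : K) + 1)) •
      ((X 0 : MvPolynomial (Fin 2) K) ^ k - (∑ i ∈ Finset.range (k + 1),
        (X 0 + X 1 + X 0 * X 1) ^ i * X 1 ^ (k - i)) * (1 + X 1)) with hE
  have h1 : X 0 * E = ∑ k ∈ Finset.range n, ((-1) ^ k / ((k : K) + 1)) •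
      ((X 0 : MvPolynomial (Fin 2) K) ^ (k + 1) - (X 0 + X 1 + X 0 * X 1) ^ (k + 1)
        + X 1 ^ (k + 1)) := by
    rw [hE, Finset.mul_sum]
    refine Finset.sum_congr rfl fun k _ => ?_
    rw [mul_smul_comm]
    congr 1
    have := geom_sum₂_mul (X 0 + X 1 + X 0 * X 1 : MvPolynomial (Fin 2) K) (X 1) (k + 1)
    rw [Nat.add_sub_cancel] at this
    linear_combination -this
  -- Multiplication by `X 0` raises the degree by one, so degree `j + 1` is needed; this is why `j <
  -- n` is assumed.
  have h2 := coeff_truncated_log_eq_zero K (X 0 : MvPolynomial (Fin 2) K) (X 1)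
    (Nat.succ_le_of_lt hj)
  have h3 := congrArg (fun p => PowerSeries.coeff (j + 1) (aeval (fun i =>
    PowerSeries.C (X i) * PowerSeries.X : Fin 2 → PowerSeries (MvPolynomial (Fin 2) K)) p)) h1
  simp only [map_sum, map_smul, map_add, map_sub, map_mul, map_pow, aeval_X] at h3
  simp only [map_sum] at h2
  rw [h2, mul_assoc, PowerSeries.coeff_C_mul, mul_comm PowerSeries.X,
    PowerSeries.coeff_succ_mul_X, coeff_aeval_C_mul_X] at h3
  exact (mul_eq_zero.mp h3).resolve_left (X_ne_zero 0)

end LogIdentity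

namespace NCSeries

/-! ### Conjugation and one-sided multiplication as commuting operators. -/

section Conjugation

variable {σ K : Type*} [Field K]

/-- `Z ↦ W * Z * W' - Z`, as a linear map. -/
noncomputable def conjSub (W W' : NCSeries σ K) : NCSeries σ K →ₗ[K] NCSeries σ K :=
  LinearMap.mulLeft K W ∘ₗ LinearMap.mulRight K W' - LinearMap.id

theorem conjSub_apply (W W' Z : NCSeries σ K) : conjSub W W' Z = W * (Z * W') - Z := rfl

/-- Because $WZW'-Z=[W-1,Z]W'$, and $W-1$ has no constant term. -/
theorem conjSub_mem_orderGE {W W' : NCSeries σ K} (hW : W - 1 ∈ orderGE σ K 1)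
    (hW' : W * W' = 1) {n : ℕ} {Z : NCSeries σ K} (hZ : Z ∈ orderGE σ K n) :
    conjSub W W' Z ∈ orderGE σ K (n + 1) := by
  have : conjSub W W' Z = ((W - 1) * Z - Z * (W - 1)) * W' := by
    simp only [conjSub_apply, sub_mul, mul_sub, mul_one, one_mul, mul_assoc, hW']
    abel
  rw [this]
  exact mul_mem_orderGE_right _ (sub_mem (add_comm 1 n ▸ mul_mem_orderGE hW hZ)
    (mul_mem_orderGE hZ hW))

variable (W W' Y : NCSeries σ K)

open MvPolynomial in
/-- The linear map that sends `q ^ a * r ^ b` to `Q ^ a (Y) * (W - 1) ^ b`,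
where `Q = conjSub W W'`. -/
noncomputable def evalConj : MvPolynomial (Fin 2) K →ₗ[K] NCSeries σ K :=
  (basisMonomials (Fin 2) K).constr K fun d => ((conjSub W W') ^ (d 0)) Y * (W - 1) ^ (d 1)

open MvPolynomial

theorem evalConj_monomial (d : Fin 2 →₀ ℕ) (c : K) :
    evalConj W W' Y (monomial d c) = c • (((conjSub W W') ^ (d 0)) Y * (W - 1) ^ (d 1)) := by
  rw [← mul_one c, ← smul_eq_mul, ← smul_monomial, map_smul, smul_eq_mul, mul_one]
  congr 1
  have := (basisMonomials (Fin 2) K).constr_basis K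
    (fun d => ((conjSub W W') ^ (d 0)) Y * (W - 1) ^ (d 1)) d
  rwa [coe_basisMonomials] at this

theorem evalConj_mul_X_one (p : MvPolynomial (Fin 2) K) :
    evalConj W W' Y (p * X 1) = evalConj W W' Y p * (W - 1) := by
  induction p using MvPolynomial.induction_on' with
  | monomial d c =>
    rw [X, monomial_mul, mul_one, evalConj_monomial, evalConj_monomial, smul_mul_assoc]
    simp [pow_succ, mul_assoc]
  | add p q hp hq => rw [add_mul, map_add, hp, hq, map_add, add_mul]

variable {W W'} (hW : W * W' = 1) (hW' : W' * W = 1)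
include hW hW'

theorem conjSub_mul_comm (Z : NCSeries σ K) :
    conjSub W W' (Z * (W - 1)) = conjSub W W' Z * (W - 1) := by
  simp only [conjSub_apply, sub_mul, mul_sub, mul_one, mul_assoc, hW, hW']
  abel

theorem evalConj_mul_X_zero (p : MvPolynomial (Fin 2) K) :
    evalConj W W' Y (p * X 0) = conjSub W W' (evalConj W W' Y p) := by
  have h : ∀ (k : ℕ) (Z : NCSeries σ K),
      conjSub W W' (Z * (W - 1) ^ k) = conjSub W W' Z * (W - 1) ^ k := by
    intro k
    induction k with
    | zero => simp
    | succ k ih => intro Z; rw [pow_succ, ← mul_assoc, conjSub_mul_comm hW hW', ih, mul_assoc]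
  induction p using MvPolynomial.induction_on' with
  | monomial d c =>
    rw [X, monomial_mul, mul_one, evalConj_monomial, evalConj_monomial, map_smul, h]
    simp [pow_succ']
  | add p q hp hq => rw [add_mul, map_add, hp, hq, map_add, map_add]

/-- Conjugation followed by right multiplication by $W$ is left multiplication by $W$: $(1+q)(1+r)$
sends $Z$ to $WZW'W=WZ$. -/
theorem evalConj_mul_left (p : MvPolynomial (Fin 2) K) :
    evalConj W W' Y (p * (X 0 + X 1 + X 0 * X 1)) = (W - 1) * evalConj W W' Y p := by
  rw [mul_add, mul_add, mul_comm (X 0) (X 1), ← mul_assoc, map_add, map_add,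
    evalConj_mul_X_zero Y hW hW', evalConj_mul_X_zero Y hW hW', evalConj_mul_X_one,
    conjSub_mul_comm hW hW', conjSub_apply]
  simp only [sub_mul, mul_sub, mul_one, one_mul, mul_assoc, hW']
  abel

theorem evalConj_pow_mul_pow (i j : ℕ) :
    evalConj W W' Y ((X 0 + X 1 + X 0 * X 1) ^ i * X 1 ^ j) = (W - 1) ^ i * Y * (W - 1) ^ j := by
  induction j with
  | zero =>
    induction i with
    | zero => simpa using evalConj_monomial W W' Y 0 1
    | succ i ih =>
      rw [pow_zero, mul_one] at ih ⊢
      rw [pow_succ, evalConj_mul_left Y hW hW', ih]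
      simp [pow_succ', mul_assoc]
  | succ j ih => rw [pow_succ, ← mul_assoc, evalConj_mul_X_one, ih, pow_succ, ← mul_assoc]

/-- The polynomial logarithm identity evaluated at these operators. What survives truncation has
total degree at least $n$, and each operator raises the order by at least one. -/
theorem sum_conjSub_pow_sub_mem [CharZero K] (hT : W - 1 ∈ orderGE σ K 1) (n : ℕ) :
    ∑ k ∈ Finset.range n, ((-1) ^ k / ((k : K) + 1)) • ((conjSub W W' ^ k) Y
      - (∑ i ∈ Finset.range (k + 1), (W - 1) ^ i * Y * (W - 1) ^ (k - i)) * W)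
      ∈ orderGE σ K n := by
  have h0 : ∀ k : ℕ, evalConj W W' Y (X 0 ^ k) = (conjSub W W' ^ k) Y := by
    intro k
    induction k with
    | zero => simpa using evalConj_monomial W W' Y 0 1
    | succ k ih =>
      rw [pow_succ, evalConj_mul_X_zero Y hW hW', ih, pow_succ', Module.End.mul_apply]
  have h1 : ∀ p, evalConj W W' Y (p * (1 + X 1)) = evalConj W W' Y p * W := by
    intro p
    rw [mul_add, map_add, evalConj_mul_X_one, mul_one]
    noncomm_ring
  set E := ∑ k ∈ Finset.range n, ((-1) ^ k / ((k : K) + 1)) •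
      ((X 0 : MvPolynomial (Fin 2) K) ^ k - (∑ i ∈ Finset.range (k + 1),
        (X 0 + X 1 + X 0 * X 1) ^ i * X 1 ^ (k - i)) * (1 + X 1)) with hE
  have h2 : evalConj W W' Y E ∈ orderGE σ K n := by
    rw [E.as_sum, map_sum]
    refine sum_mem fun d hd => ?_
    rw [evalConj_monomial]
    refine Submodule.smul_mem _ _ ?_
    have hd' : n ≤ d 0 + d 1 := by
      by_contra hlt
      rw [not_le] at hlt
      have := congrArg (MvPolynomial.coeff d) (homogeneousComponent_truncated_log_eq_zero K hlt)
      rw [← hE, coeff_homogeneousComponent, if_pos, MvPolynomial.coeff_zero] at this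
      · exact (mem_support_iff.mp hd) this
      · rw [Finsupp.degree_eq_sum, Fin.sum_univ_two]
    refine orderGE_anti hd' (mul_mem_orderGE ?_ (pow_mem_orderGE hT _))
    generalize d 0 = k
    induction k with
    | zero => exact mem_orderGE_zero _
    | succ k ih =>
      rw [pow_succ', Module.End.mul_apply]
      exact conjSub_mem_orderGE hT hW ih
  rw [hE, map_sum] at h2
  simpa only [map_smul, map_sub, h0, h1, map_sum, evalConj_pow_mul_pow Y hW hW'] using h2

end Conjugation

/-! ### Letter-counting derivations and their values on exponentials. -/

section LetterDeriv

variable {σ K : Type*} [Field K] [DecidableEq σ]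

/-- The derivation that multiplies a word by its number of letters `c`. -/
def letterDeriv (c : σ) : NCSeries σ K →ₗ[K] NCSeries σ K where
  toFun f w := (w.count c : K) * f.coeff w
  map_add' f g := ext fun w => mul_add (w.count c : K) (f.coeff w) (g.coeff w)
  map_smul' a f := ext fun w => mul_left_comm (w.count c : K) a (f.coeff w)

theorem coeff_letterDeriv (c : σ) (f : NCSeries σ K) (w : List σ) :
    (letterDeriv c f).coeff w = (w.count c : K) * f.coeff w := rfl

theorem letterDeriv_mul (c : σ) (f g : NCSeries σ K) :
    letterDeriv c (f * g) = letterDeriv c f * g + f * letterDeriv c g := by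
  ext w
  rw [coeff_letterDeriv, coeff_add, coeff_mul, coeff_mul, coeff_mul, Finset.mul_sum,
    ← Finset.sum_add_distrib]
  refine Finset.sum_congr rfl fun k _ => ?_
  have : w.count c = (w.take k).count c + (w.drop k).count c := by
    rw [← List.count_append, List.take_append_drop]
  rw [coeff_letterDeriv, coeff_letterDeriv, this]
  push_cast
  ring

@[simp] theorem letterDeriv_one (c : σ) : letterDeriv c (1 : NCSeries σ K) = 0 := by
  ext w
  cases w <;> simp [coeff_letterDeriv]

theorem letterDeriv_pow_succ (c : σ) (f : NCSeries σ K) (k : ℕ) :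
    letterDeriv c (f ^ (k + 1)) =
      ∑ i ∈ Finset.range (k + 1), f ^ i * letterDeriv c f * f ^ (k - i) := by
  induction k with
  | zero => simp
  | succ k ih =>
    rw [pow_succ', letterDeriv_mul, ih, Finset.sum_range_succ' _ (k + 1), Finset.mul_sum,
      add_comm]
    congr 1
    · refine Finset.sum_congr rfl fun i _ => ?_
      rw [pow_succ', Nat.add_sub_add_right]
      simp only [mul_assoc]
    · simp

theorem letterDeriv_mem_orderGE (c : σ) {n : ℕ} {f : NCSeries σ K} (hf : f ∈ orderGE σ K n) :
    letterDeriv c f ∈ orderGE σ K n :=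
  fun w hw => mul_eq_zero_of_right _ (hf w hw)

theorem letterDeriv_var_pow (a c : σ) (k : ℕ) :
    letterDeriv c ((var a : NCSeries σ K) ^ k) = if a = c then (k : K) • var a ^ k else 0 := by
  ext w
  rw [coeff_letterDeriv, coeff_var_pow]
  by_cases h : w = List.replicate k a
  · rw [if_pos h, h, List.count_replicate]
    by_cases h' : a = c <;> simp [h', coeff_var_pow]
  · rw [if_neg h, mul_zero]
    by_cases h' : a = c
    · rw [if_pos h', coeff_smul, coeff_var_pow, if_neg h, mul_zero]
    · rw [if_neg h', coeff_zero]

theorem letterDeriv_exp_var_of_ne {a c : σ} (h : a ≠ c) :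
    letterDeriv c (exp (var a : NCSeries σ K)) = 0 := by
  refine eq_zero_of_mem_orderGE fun n => ?_
  have := letterDeriv_mem_orderGE c (exp_sub_sum_mem (var_mem_orderGE (K := K) a) n)
  rw [map_sub, map_sum, Finset.sum_eq_zero, sub_zero] at this
  · exact this
  · intro k _
    rw [map_smul, letterDeriv_var_pow, if_neg h, smul_zero]

theorem letterDeriv_exp_var [CharZero K] (a : σ) :
    letterDeriv a (exp (var a : NCSeries σ K)) = exp (var a) * var a := by
  rw [← sub_eq_zero]
  refine eq_zero_of_mem_orderGE fun n => ?_
  have hv : (var a : NCSeries σ K) ∈ orderGE σ K 1 := var_mem_orderGE a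
  -- One more term is kept here: the derivation kills the constant term, and the remaining `n` terms
  -- become the truncation at `n` times `var a`.
  have h1 := letterDeriv_mem_orderGE a (exp_sub_sum_mem hv (n + 1))
  have h2 := mul_mem_orderGE (exp_sub_sum_mem hv n) hv
  convert orderGE_anti (Nat.le_succ n) (sub_mem h1 h2) using 1
  rw [map_sub, map_sum, sub_mul, Finset.sum_mul, Finset.sum_range_succ']
  simp only [map_smul, letterDeriv_var_pow, if_pos, smul_smul, smul_mul_assoc, ← pow_succ]
  have : ∀ k : ℕ, 1 / ((k + 1).factorial : K) * ((k + 1 : ℕ) : K) = 1 / (k.factorial : K) := by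
    intro k
    have h1 : ((k + 1 : ℕ) : K) ≠ 0 := Nat.cast_ne_zero.mpr k.succ_ne_zero
    rw [Nat.factorial_succ, Nat.cast_mul]
    field_simp
  simp only [this, Nat.cast_zero, mul_zero, zero_smul, add_zero]
  abel

theorem exp_neg_mul_exp_var [Fintype σ] [CharZero K] (a : σ) :
    exp (-var a) * exp (var a) = (1 : NCSeries σ K) := by
  have hv : (var a : NCSeries σ K) ∈ orderGE σ K 1 := var_mem_orderGE a
  rw [← exp_var_mul_exp_neg a]
  exact subst_commute _ _ (neg_mem hv) hv (Commute.neg_left rfl)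

end LetterDeriv

/-! ### The derivative of the Baker–Campbell–Hausdorff series as an adjoint action. -/

section BCH

variable {K : Type*} [Field K]

variable (K) in
/-- The product `e^X e^Y`. -/
noncomputable def expProd : NCSeries (Fin 2) K := exp (var 0) * exp (var 1)

variable (K) in
/-- The inverse `e^{-Y} e^{-X}` of `e^X e^Y`. -/
noncomputable def expProdInv : NCSeries (Fin 2) K := exp (-var 1) * exp (-var 0)

theorem expProd_sub_one_mem : expProd K - 1 ∈ orderGE (Fin 2) K 1 := by
  rw [mem_orderGE_one, expProd]
  simp

theorem bchSeries_sub_sum_mem (n : ℕ) :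
    bchSeries K - ∑ k ∈ Finset.range n, ((-1) ^ k / ((k : K) + 1)) • (expProd K - 1) ^ (k + 1)
      ∈ orderGE (Fin 2) K (n + 1) := by
  have := subst_sub_sum_mem (fun k => if k = 0 then 0 else (-1) ^ (k - 1) / (k : K))
    (expProd_sub_one_mem (K := K)) (n + 1)
  rw [Finset.sum_range_succ'] at this
  rw [show bchSeries K = subst (fun k => if k = 0 then 0 else (-1) ^ (k - 1) / (k : K))
    (expProd K - 1) from rfl]
  simpa using this

variable [CharZero K]

theorem expProd_mul_inv : expProd K * expProdInv K = 1 := by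
  rw [expProd, expProdInv, mul_assoc, ← mul_assoc (exp (var 1)), exp_var_mul_exp_neg, one_mul,
    exp_var_mul_exp_neg]

theorem expProdInv_mul : expProdInv K * expProd K = 1 := by
  rw [expProd, expProdInv, mul_assoc, ← mul_assoc (exp (-var 0)), exp_neg_mul_exp_var, one_mul,
    exp_neg_mul_exp_var]

theorem adAct_expProd (Z : NCSeries (Fin 2) K) :
    adAct Z (expProd K) = expProd K * Z * expProdInv K := by
  rw [expProd, expProdInv, adAct_mul, adAct_exp_var, adAct_exp_var]
  simp only [mul_assoc]

theorem adAct_expProd_sub_one_pow (Z : NCSeries (Fin 2) K) (k : ℕ) :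
    adAct Z ((expProd K - 1) ^ k) = (conjSub (expProd K) (expProdInv K) ^ k) Z := by
  induction k with
  | zero => simp
  | succ k ih =>
    rw [pow_succ', adAct_mul, ih, map_sub, adAct_expProd, adAct_one, pow_succ',
      Module.End.mul_apply, conjSub_apply, mul_assoc]

theorem letterDeriv_expProd : letterDeriv 1 (expProd K) = expProd K * var 1 := by
  rw [expProd, letterDeriv_mul, letterDeriv_exp_var, letterDeriv_exp_var_of_ne (by decide),
    zero_mul, zero_add, mul_assoc]

/-- The series `∑ (-1) ^ k / (k + 1) • W * (W - 1) ^ k`, truncated, for `W = e^X e^Y`. -/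
noncomputable def truncatedLogDeriv (K : Type*) [Field K] (n : ℕ) : NCSeries (Fin 2) K :=
  ∑ k ∈ Finset.range n, ((-1) ^ k / ((k : K) + 1)) • (expProd K * (expProd K - 1) ^ k)

/-- The Leibniz rule gives the sums of $T^i\,WY\,T^{k-i}$, while $WT^k$ acts on $Y$ as $q^k$
followed by conjugation by $W$. The operator identity `sum_conjSub_pow_sub_mem`, conjugated by $W$,
matches the two. -/
theorem letterDeriv_bchSeries_sub_mem (n : ℕ) :
    letterDeriv 1 (bchSeries K) - adAct (var 1) (truncatedLogDeriv K n)
      ∈ orderGE (Fin 2) K n := by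
  have h1 := letterDeriv_mem_orderGE 1 (bchSeries_sub_sum_mem (K := K) n)
  have h2 := mul_mem_orderGE_left (expProd K) (mul_mem_orderGE_right (expProdInv K)
    (sum_conjSub_pow_sub_mem (var 1) expProd_mul_inv expProdInv_mul
      (expProd_sub_one_mem (K := K)) n))
  convert sub_mem (orderGE_anti (Nat.le_succ n) h1) h2 using 1
  have hc : ∀ i, (expProd K - 1) ^ i * expProd K = expProd K * (expProd K - 1) ^ i := fun i =>
    (((Commute.refl (expProd K)).sub_left (Commute.one_left _)).pow_left i)
  simp only [map_sub, map_sum, map_smul, letterDeriv_pow_succ, letterDeriv_one, sub_zero,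
    letterDeriv_expProd, truncatedLogDeriv, adAct_mul, adAct_expProd_sub_one_pow, adAct_expProd,
    Finset.sum_mul, Finset.mul_sum, mul_sub, sub_mul, smul_sub, Finset.sum_sub_distrib,
    mul_smul_comm, smul_mul_assoc]
  -- Since $T$ commutes with $W$, each Leibniz term is the conjugate by $W$ of $T^iYT^{k-i}W$.
  have : ∀ k i, (expProd K - 1) ^ i * (expProd K * var 1) * (expProd K - 1) ^ (k - i) =
      expProd K * ((expProd K - 1) ^ i * var 1 * (expProd K - 1) ^ (k - i) * expProd K
        * expProdInv K) := by
    intro k i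
    rw [mul_assoc _ (expProd K) (expProdInv K), expProd_mul_inv, mul_one, ← mul_assoc, hc]
    simp only [mul_assoc]
  simp only [this, mul_assoc]
  abel

end BCH

/-! ### Cuttings of words of distinct letters and the beta integral. -/

section Increasing

variable (K α : Type*) [Field K] [LinearOrder α]

/-- The sum of all strictly increasing words; for finite `α` this is the ordered product of the
series `1 + a` over all variables `a`. -/
noncomputable def increasing : NCSeries α K := fun l => if l.Pairwise (· < ·) then 1 else 0

variable {K α}

theorem coeff_increasing (l : List α) :
    (increasing K α).coeff l = if l.Pairwise (· < ·) then 1 else 0 := rfl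

theorem leftQuotient_leftQuotient_increasing (a b : α) :
    leftQuotient b (leftQuotient a (increasing K α)) =
      if a < b then leftQuotient b (increasing K α) else 0 := by
  ext l
  change (increasing K α).coeff (a :: b :: l) = _
  have : (a :: b :: l).Pairwise (· < ·) ↔ a < b ∧ (b :: l).Pairwise (· < ·) := by
    simp only [← List.isChain_iff_pairwise, List.isChain_cons_cons]
  rw [coeff_increasing]
  by_cases h : a < b
  · rw [if_pos h]
    simp only [this, h, true_and]
    rfl
  · rw [if_neg h, if_neg (fun h' => h (this.mp h').1), coeff_zero]

theorem coeff_increasing_sub_one_pow_cons (k : ℕ) (a : α) (l : List α) :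
    ((increasing K α - 1) ^ (k + 1)).coeff (a :: l) =
      (leftQuotient a (increasing K α) * (increasing K α - 1) ^ k).coeff l := by
  rw [pow_succ', coeff_mul_cons, coeff_sub, coeff_increasing]
  simp only [List.Pairwise.nil, if_true, coeff_one_nil, sub_self, zero_mul, zero_add]
  congr 2
  exact ext fun u => sub_zero ((increasing K α).coeff (a :: u))

/-- A cutting of the word into nonempty increasing pieces either cuts between $a$ and $b$, using up
the piece $a$, or keeps them together, which requires $a<b$. -/
theorem coeff_increasing_sub_one_pow_cons_cons (k : ℕ) (a b : α) (l : List α) :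
    ((increasing K α - 1) ^ (k + 1)).coeff (a :: b :: l) =
      ((increasing K α - 1) ^ k).coeff (b :: l) +
        if a < b then ((increasing K α - 1) ^ (k + 1)).coeff (b :: l) else 0 := by
  rw [coeff_increasing_sub_one_pow_cons, coeff_mul_cons, leftQuotient_leftQuotient_increasing]
  congr 1
  · change (increasing K α).coeff [a] * _ = _
    simp [coeff_increasing]
  · by_cases h : a < b
    · rw [if_pos h, if_pos h, coeff_increasing_sub_one_pow_cons]
    · rw [if_neg h, if_neg h, zero_mul, coeff_zero]

/-- The number of descents of a word. -/
def descents : List α → ℕ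
  | a :: b :: l => (if b < a then 1 else 0) + descents (b :: l)
  | _ => 0

theorem descents_lt_length (a : α) (l : List α) : descents (a :: l) < (a :: l).length := by
  induction l generalizing a with
  | nil => simp [descents]
  | cons b l ih =>
    have := ih b
    rw [descents, List.length_cons]
    split_ifs <;> omega

theorem increasing_sub_one_mem : increasing K α - 1 ∈ orderGE α K 1 := by
  rw [mem_orderGE_one]
  simp [coeff_increasing]

/-- With $d$ forced and $e$ optional cuts, $k$ cuts have generating function $x^d(1+x)^e$. As
$\frac1{k+s+1}=\int_0^1x^{k+s}\,dx$, the sum is $(-1)^{s+d}\int_0^1x^{s+d}(1-x)^e\,dx$. The shift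
$s$ is what makes the induction on the word close up. -/
theorem sum_coeff_increasing_sub_one_pow [CharZero K] (l : List α) (hl : l.Nodup) (n s d e : ℕ)
    (hn : l.length ≤ n) (hd : descents l = d) (he : l.length = d + e + 1) :
    ∑ k ∈ Finset.range n, ((-1) ^ (k + s) / (((k + s : ℕ) : K) + 1)) *
      ((increasing K α - 1) ^ (k + 1)).coeff l =
    (-1) ^ (s + d) * ((s + d).factorial * e.factorial) / (s + d + e + 1).factorial := by
  induction l generalizing n s d e with
  | nil => simp at he
  | cons a l ih =>
    obtain ⟨n, rfl⟩ : ∃ m, n = m + 1 := ⟨n - 1, by rw [List.length_cons] at hn; omega⟩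
    cases l with
    | nil =>
      obtain rfl : d = 0 := by simpa [descents] using hd.symm
      obtain rfl : e = 0 := by simpa using he.symm
      have h0 : ((s : K) + 1) ≠ 0 := by exact_mod_cast s.succ_ne_zero
      have h1 : (s.factorial : K) ≠ 0 := Nat.cast_ne_zero.mpr s.factorial_ne_zero
      rw [Finset.sum_eq_single 0]
      · simp only [zero_add, add_zero, pow_one, coeff_sub, coeff_increasing, Nat.factorial_succ]
        simp
        field_simp
      · intro k _ hk
        rw [pow_mem_orderGE increasing_sub_one_mem (k + 1) _ (by simpa using by omega), mul_zero]
      · simp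
    | cons b l =>
      have hlen := descents_lt_length b l
      have hl' := (List.nodup_cons.mp hl).2
      have hab : a ≠ b := fun h => (List.nodup_cons.mp hl).1 (h ▸ List.mem_cons_self)
      rw [List.length_cons] at hn he
      simp only [coeff_increasing_sub_one_pow_cons_cons, mul_add, Finset.sum_add_distrib]
      rw [Finset.sum_range_succ']
      simp only [pow_zero, coeff_one_cons, mul_zero, add_zero]
      rw [descents] at hd
      rcases lt_or_gt_of_ne hab with h | h
      -- An ascent: cutting raises `s` by one, not cutting leaves it, and both cases have one
      -- optional cut fewer. The two values add up by the recursion of the beta function.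
      · rw [if_neg h.not_gt, zero_add] at hd
        obtain ⟨e, rfl⟩ : ∃ e', e = e' + 1 := ⟨e - 1, by omega⟩
        simp only [if_pos h]
        have i1 := ih hl' n (s + 1) d e (by omega) hd (by omega)
        have i2 := ih hl' (n + 1) s d e (by omega) hd (by omega)
        simp only [show ∀ k, k + 1 + s = k + (s + 1) from fun k => by omega]
        rw [i1, i2]
        rw [show s + 1 + d = s + d + 1 by omega, show s + d + 1 + e + 1 = s + d + e + 1 + 1 by omega,
          show s + d + (e + 1) + 1 = s + d + e + 1 + 1 by omega, Nat.factorial_succ (s + d + e + 1),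
          Nat.factorial_succ (s + d), Nat.factorial_succ e]
        have h1 : ((s + d + e + 1).factorial : K) ≠ 0 :=
          Nat.cast_ne_zero.mpr (Nat.factorial_ne_zero _)
        have h2 : ((s : K) + d + e + 1 + 1) ≠ 0 := by
          exact_mod_cast (s + d + e + 1).succ_ne_zero
        push_cast
        field_simp
        ring
      -- A descent: the cut is forced, and the increase of `s` compensates for the descent removed.
      · rw [if_pos h] at hd
        simp only [if_neg h.not_gt, mul_zero, Finset.sum_const_zero, add_zero]
        have i1 := ih hl' n (s + 1) (d - 1) e (by omega) (by omega) (by omega)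
        simp only [show ∀ k, k + 1 + s = k + (s + 1) from fun k => by omega]
        rw [i1, show s + 1 + (d - 1) = s + d by omega]

theorem coeff_sum_increasing [CharZero K] (l : List α) (hl : l.Nodup) (n d e : ℕ)
    (hn : l.length < n) (hd : descents l = d) (he : l.length = d + e + 1) :
    (∑ k ∈ Finset.range n, ((-1) ^ k / ((k : K) + 1)) •
      (increasing K α * (increasing K α - 1) ^ k)).coeff l =
    (-1) ^ d * (d.factorial * (e + 1).factorial) / (d + e + 2).factorial := by
  have h : ∀ k, increasing K α * (increasing K α - 1) ^ k =
      (increasing K α - 1) ^ k + (increasing K α - 1) ^ (k + 1) := fun k => by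
    rw [pow_succ', sub_mul, one_mul, add_sub_cancel]
  obtain ⟨n, rfl⟩ : ∃ m, n = m + 1 := ⟨n - 1, by omega⟩
  simp only [coeff_sum, coeff_smul, h, coeff_add, mul_add, Finset.sum_add_distrib]
  have i1 := sum_coeff_increasing_sub_one_pow (K := K) l hl (n + 1) 0 d e hn.le hd he
  -- In the part with $T^k$ the term $k=0$ vanishes on a nonempty word; reindexing the rest gives
  -- the shift $s=1$, while $T^{k+1}$ gives $s=0$.
  rw [Finset.sum_range_succ', pow_zero (increasing K α - 1),
    coeff_one_of_ne_nil (fun h => by simp [h] at he), mul_zero, add_zero]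
  have i2 := sum_coeff_increasing_sub_one_pow (K := K) l hl n 1 d e (by omega) hd he
  simp only [add_zero, zero_add] at i1
  rw [i1, i2, show 1 + d + e + 1 = d + e + 1 + 1 by omega, show 1 + d = d + 1 by omega,
    show d + e + 2 = d + e + 1 + 1 by omega, Nat.factorial_succ (d + e + 1),
    Nat.factorial_succ d, Nat.factorial_succ e]
  have h1 : ((d + e + 1).factorial : K) ≠ 0 := Nat.cast_ne_zero.mpr (Nat.factorial_ne_zero _)
  have h2 : ((d : K) + e + 1 + 1) ≠ 0 := by exact_mod_cast (d + e + 1).succ_ne_zero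
  push_cast
  field_simp
  ring

theorem descents_ofFn {n : ℕ} (f : Fin n → α) :
    descents (List.ofFn f) =
      (Finset.univ.filter fun k : Fin n => ∃ l : Fin n, (l : ℕ) = k + 1 ∧ f l < f k).card := by
  induction n with
  | zero => simp [descents]
  | succ n ih =>
    cases n with
    | zero =>
      simp only [List.ofFn_succ, List.ofFn_zero, descents]
      symm
      rw [Finset.card_eq_zero, Finset.filter_eq_empty_iff]
      rintro k - ⟨l, hl, -⟩
      omega
    | succ n =>
      rw [List.ofFn_succ, List.ofFn_succ, descents, Fin.card_filter_univ_succ]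
      have h1 := ih fun i => f i.succ
      rw [List.ofFn_succ] at h1
      rw [h1]
      have h2 : (∃ l : Fin (n + 1 + 1), (l : ℕ) = ((0 : Fin (n + 1 + 1)) : ℕ) + 1 ∧ f l < f 0) ↔
          f (Fin.succ 0) < f 0 := by
        constructor
        · rintro ⟨l, hl, h⟩
          rwa [show l = Fin.succ 0 from Fin.ext (by simpa using hl)] at h
        · exact fun h => ⟨Fin.succ 0, by simp, h⟩
      have h3 : ∀ k : Fin (n + 1), (∃ l : Fin (n + 1 + 1), (l : ℕ) = (k.succ : ℕ) + 1 ∧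
          f l < f k.succ) ↔ ∃ l : Fin (n + 1), (l : ℕ) = (k : ℕ) + 1 ∧ f l.succ < f k.succ := by
        intro k
        constructor
        · rintro ⟨l, hl, h⟩
          rw [Fin.val_succ] at hl
          refine ⟨l.pred (fun h0 => by simp [h0] at hl), by simp [hl], by simpa using h⟩
        · rintro ⟨l, hl, h⟩
          exact ⟨l.succ, by simp [hl], h⟩
      simp only [h2, h3]
      split_ifs <;> omega

end Increasing

/-! ### Polarization: passing from distinct letters to repeated ones. -/

section Arrangements

variable {K α σ : Type*} [Field K] [DecidableEq α] [DecidableEq σ]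

/-- The words in which every element of `S` occurs exactly once. -/
def arrangements (S : Finset α) : Finset (List α) := (Multiset.lists S.val).toFinset

theorem mem_arrangements {S : Finset α} {l : List α} :
    l ∈ arrangements S ↔ l.Nodup ∧ l.toFinset = S := by
  rw [arrangements, Multiset.mem_toFinset, Multiset.mem_lists_iff]
  constructor
  · intro h
    have h' : S.val = (l : Multiset α) := h
    have hl : l.Nodup := by rw [← Multiset.coe_nodup, ← h']; exact S.nodup
    refine ⟨hl, ?_⟩
    rw [← Finset.val_inj, h', List.toFinset_val, hl.dedup]
  · rintro ⟨hl, rfl⟩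
    change l.toFinset.val = (l : Multiset α)
    rw [List.toFinset_val, hl.dedup]

/-- The sum of the coefficients of `G` over the arrangements of `S` with image `w` under `π`. -/
noncomputable def arrangementSum (π : α → σ) (S : Finset α) (G : NCSeries α K) (w : List σ) : K :=
  ∑ l ∈ arrangements S with l.map π = w, G.coeff l

/-- Cutting an arrangement of $S$ at position $k$ amounts to choosing the set $T$ of letters of the
first part and arranging $T$ and $S\setminus T$ separately. -/
theorem arrangementSum_mul (π : α → σ) (S : Finset α) (G H : NCSeries α K) (w : List σ) :
    arrangementSum π S (G * H) w = ∑ k ∈ Finset.range (w.length + 1), ∑ T ∈ S.powerset,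
      arrangementSum π T G (w.take k) * arrangementSum π (S \ T) H (w.drop k) := by
  have h1 : arrangementSum π S (G * H) w = ∑ k ∈ Finset.range (w.length + 1),
      ∑ l ∈ arrangements S with l.map π = w, G.coeff (l.take k) * H.coeff (l.drop k) := by
    rw [Finset.sum_comm, arrangementSum]
    refine Finset.sum_congr rfl fun l hl => ?_
    rw [coeff_mul, ← (Finset.mem_filter.mp hl).2, List.length_map]
  rw [h1]
  refine Finset.sum_congr rfl fun k hk => ?_
  simp only [arrangementSum, Finset.sum_mul_sum, ← Finset.sum_product']
  rw [Finset.sum_sigma']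
  refine Finset.sum_bij' (fun l _ => ⟨(l.take k).toFinset, (l.take k, l.drop k)⟩)
    (fun x _ => x.2.1 ++ x.2.2) ?_ ?_ ?_ ?_ ?_
  · intro l hl
    rw [Finset.mem_filter, mem_arrangements] at hl
    obtain ⟨⟨hl, rfl⟩, rfl⟩ := hl
    have hl' := hl
    rw [← List.take_append_drop k l, List.nodup_append'] at hl'
    obtain ⟨n1, n2, n3⟩ := hl'
    simp only [Finset.mem_sigma, Finset.mem_powerset, Finset.mem_product, Finset.mem_filter,
      mem_arrangements, List.map_take, List.map_drop, and_true]
    refine ⟨fun a ha => ?_, n1, n2, ?_⟩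
    · rw [List.mem_toFinset] at ha ⊢
      exact List.mem_of_mem_take ha
    · ext a
      have h1 : a ∈ l ↔ a ∈ l.take k ∨ a ∈ l.drop k := by
        rw [← List.mem_append, List.take_append_drop]
      simp only [Finset.mem_sdiff, List.mem_toFinset]
      have := @n3 a
      tauto
  · rintro ⟨T, l₁, l₂⟩ h
    simp only [Finset.mem_sigma, Finset.mem_powerset, Finset.mem_product, Finset.mem_filter,
      mem_arrangements] at h
    obtain ⟨hT, ⟨⟨n1, rfl⟩, m1⟩, ⟨n2, h2⟩, m2⟩ := h
    rw [Finset.mem_filter, mem_arrangements, List.nodup_append', List.toFinset_append, h2,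
      List.map_append, m1, m2, List.take_append_drop]
    refine ⟨⟨⟨n1, n2, ?_⟩, Finset.union_sdiff_of_subset hT⟩, rfl⟩
    intro a ha hb
    rw [← List.mem_toFinset, h2, Finset.mem_sdiff] at hb
    exact hb.2 (List.mem_toFinset.mpr ha)
  · intro l _
    exact List.take_append_drop k l
  · rintro ⟨T, l₁, l₂⟩ h
    simp only [Finset.mem_sigma, Finset.mem_powerset, Finset.mem_product, Finset.mem_filter,
      mem_arrangements] at h
    obtain ⟨hT, ⟨⟨n1, rfl⟩, m1⟩, ⟨n2, h2⟩, m2⟩ := h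
    have hlen : l₁.length = k := by
      rw [← List.length_map (f := π), m1, List.length_take]
      rw [Finset.mem_range] at hk
      omega
    subst hlen
    simp
  · intro l _
    rfl

/-- The number of letters of `S` over every variable. -/
def fiberCard (π : α → σ) (S : Finset α) (c : σ) : ℕ := (S.filter (π · = c)).card

theorem fiberCard_sdiff_add (π : α → σ) {S T : Finset α} (h : T ⊆ S) (c : σ) :
    fiberCard π (S \ T) c + fiberCard π T c = fiberCard π S c := by
  rw [fiberCard, fiberCard, fiberCard, ← Finset.card_sdiff_add_card_eq_card
    (Finset.filter_subset_filter _ h)]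
  congr 2
  ext a
  simp only [Finset.mem_sdiff, Finset.mem_filter]
  tauto

variable [Fintype σ]

theorem card_powerset_fiberCard (π : α → σ) (S : Finset α) (t : σ → ℕ) :
    (S.powerset.filter fun T => fiberCard π T = t).card =
      ∏ c, (fiberCard π S c).choose (t c) := by
  simp only [fiberCard, ← Finset.card_powersetCard]
  rw [← Fintype.card_piFinset]
  refine Finset.card_bij' (fun T _ c => T.filter (π · = c))
    (fun f _ => Finset.univ.biUnion f) ?_ ?_ ?_ ?_
  · intro T hT
    rw [Finset.mem_filter, Finset.mem_powerset] at hT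
    rw [Fintype.mem_piFinset]
    exact fun c => Finset.mem_powersetCard.mpr
      ⟨Finset.filter_subset_filter _ hT.1, congrFun hT.2 c⟩
  · intro f hf
    simp only [Fintype.mem_piFinset, Finset.mem_powersetCard] at hf
    rw [Finset.mem_filter, Finset.mem_powerset]
    refine ⟨Finset.biUnion_subset.mpr fun c _ => (hf c).1.trans (Finset.filter_subset _ _), ?_⟩
    refine funext fun c => ?_
    rw [← (hf c).2]
    refine congrArg Finset.card (Finset.ext fun a => ?_)
    simp only [Finset.mem_filter, Finset.mem_biUnion, Finset.mem_univ, true_and]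
    constructor
    · rintro ⟨⟨c', h⟩, rfl⟩
      rwa [(Finset.mem_filter.mp ((hf c').1 h)).2]
    · exact fun h => ⟨⟨c, h⟩, (Finset.mem_filter.mp ((hf c).1 h)).2⟩
  · intro T _
    ext a
    simp
  · intro f hf
    simp only [Fintype.mem_piFinset, Finset.mem_powersetCard] at hf
    ext c a
    simp only [Finset.mem_filter, Finset.mem_biUnion, Finset.mem_univ, true_and]
    constructor
    · rintro ⟨⟨c', h⟩, rfl⟩
      rwa [(Finset.mem_filter.mp ((hf c').1 h)).2]
    · exact fun h => ⟨⟨c, h⟩, (Finset.mem_filter.mp ((hf c).1 h)).2⟩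

/-- `g` is obtained from the multilinear part of `G` by replacing every letter `a` by `π a` and
dividing by the number of permutations of the letters that have the same image. -/
def IsSpecialization (π : α → σ) (G : NCSeries α K) (g : NCSeries σ K) : Prop :=
  ∀ (S : Finset α) (w : List σ), arrangementSum π S G w =
    if fiberCard π S = fun c => w.count c then
      (∏ c, ((fiberCard π S c).factorial : K)) * g.coeff w else 0

variable {π : α → σ} {G H : NCSeries α K} {g h : NCSeries σ K}

theorem IsSpecialization.sub (hG : IsSpecialization π G g) (hH : IsSpecialization π H h) :
    IsSpecialization π (G - H) (g - h) := by
  intro S w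
  have : arrangementSum π S (G - H) w = arrangementSum π S G w - arrangementSum π S H w :=
    Finset.sum_sub_distrib _ _
  rw [this, hG, hH]
  split_ifs
  · rw [coeff_sub, mul_sub]
  · rw [sub_zero]

theorem IsSpecialization.smul (hG : IsSpecialization π G g) (c : K) :
    IsSpecialization π (c • G) (c • g) := by
  intro S w
  have : arrangementSum π S (c • G) w = c * arrangementSum π S G w :=
    (Finset.mul_sum _ _ _).symm
  rw [this, hG]
  split_ifs
  · rw [coeff_smul, mul_left_comm]
  · rw [mul_zero]

theorem IsSpecialization.sum {ι : Type*} (s : Finset ι) {G : ι → NCSeries α K}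
    {g : ι → NCSeries σ K} (hG : ∀ i ∈ s, IsSpecialization π (G i) (g i)) :
    IsSpecialization π (∑ i ∈ s, G i) (∑ i ∈ s, g i) := by
  intro S w
  have : arrangementSum π S (∑ i ∈ s, G i) w = ∑ i ∈ s, arrangementSum π S (G i) w := by
    simp only [arrangementSum, coeff_sum]
    exact Finset.sum_comm
  rw [this, coeff_sum, Finset.mul_sum, Finset.ite_sum_zero]
  exact Finset.sum_congr rfl fun i hi => hG i hi S w

theorem IsSpecialization.one (π : α → σ) :
    IsSpecialization π (1 : NCSeries α K) (1 : NCSeries σ K) := by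
  intro S w
  have h1 : arrangementSum π S (1 : NCSeries α K) w =
      if S = ∅ ∧ w = [] then 1 else 0 := by
    rw [arrangementSum]
    split_ifs with h
    · obtain ⟨rfl, rfl⟩ := h
      rw [Finset.sum_eq_single_of_mem []]
      · simp
      · simp [mem_arrangements]
      · intro l _ hl
        exact coeff_one_of_ne_nil hl
    · refine Finset.sum_eq_zero fun l hl => coeff_one_of_ne_nil ?_
      rintro rfl
      rw [Finset.mem_filter, mem_arrangements] at hl
      exact h ⟨hl.1.2.symm, hl.2.symm⟩
  rw [h1]
  cases w with
  | nil =>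
    have h2 : S = ∅ ↔ fiberCard π S = fun c => ([] : List σ).count c := by
      constructor
      · rintro rfl
        ext c
        simp [fiberCard]
      · intro h
        refine Finset.eq_empty_of_forall_notMem fun a ha => ?_
        have := congrFun h (π a)
        rw [fiberCard, List.count_nil, Finset.card_eq_zero, Finset.filter_eq_empty_iff] at this
        exact this ha rfl
    by_cases hS : S = ∅
    · rw [if_pos ⟨hS, rfl⟩, if_pos (h2.mp hS), coeff_one_nil, hS]
      simp [fiberCard]
    · rw [if_neg (fun h => hS h.1), if_neg (fun h => hS (h2.mpr h))]
  | cons c w => simp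

/-- The nonzero summands belong to the subsets $T$ with the letter counts of the prefix, and all are
equal. Their number is a product of binomial coefficients, which turns the factorials of the two
parts into those of $S$. -/
theorem IsSpecialization.mul [CharZero K] (hG : IsSpecialization π G g)
    (hH : IsSpecialization π H h) : IsSpecialization π (G * H) (g * h) := by
  intro S w
  rw [arrangementSum_mul, coeff_mul, Finset.mul_sum, Finset.ite_sum_zero]
  refine Finset.sum_congr rfl fun k _ => ?_
  have hw : ∀ c, (w.take k).count c + (w.drop k).count c = w.count c := fun c => by
    rw [← List.count_append, List.take_append_drop]
  split_ifs with hS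
  · have h1 : ∀ T ∈ S.powerset, arrangementSum π T G (w.take k) *
        arrangementSum π (S \ T) H (w.drop k) =
        if fiberCard π T = fun c => (w.take k).count c then
          (∏ c, (((w.take k).count c).factorial : K)) * (∏ c, (((w.drop k).count c).factorial : K))
            * (g.coeff (w.take k) * h.coeff (w.drop k)) else 0 := by
      intro T hT
      rw [hG, hH]
      split_ifs with h1 h2 h2
      · rw [h1, h2]
        ring
      · refine absurd (funext fun c => ?_) h2
        have e1 := fiberCard_sdiff_add π (Finset.mem_powerset.mp hT) c
        have e2 := congrFun h1 c
        have e3 := congrFun hS c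
        have e4 := hw c
        omega
      · rw [zero_mul]
      · rw [zero_mul]
    rw [Finset.sum_congr rfl h1, ← Finset.sum_filter, Finset.sum_const, card_powerset_fiberCard,
      nsmul_eq_mul, ← mul_assoc]
    congr 1
    push_cast
    rw [← Finset.prod_mul_distrib, ← Finset.prod_mul_distrib]
    refine Finset.prod_congr rfl fun c _ => ?_
    rw [hS]
    beta_reduce
    rw [← hw c, ← mul_assoc]
    have := Nat.choose_mul_factorial_mul_factorial
      (Nat.le_add_right ((w.take k).count c) ((w.drop k).count c))
    rw [Nat.add_sub_cancel_left] at this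
    exact_mod_cast this
  · refine Finset.sum_eq_zero fun T hT => ?_
    rw [hG, hH]
    split_ifs with h1 h2
    · refine absurd (funext fun c => ?_) hS
      have e1 := fiberCard_sdiff_add π (Finset.mem_powerset.mp hT) c
      have e2 := congrFun h1 c
      have e3 := congrFun h2 c
      have e4 := hw c
      omega
    · rw [mul_zero]
    · rw [zero_mul]
    · rw [zero_mul]

theorem IsSpecialization.pow [CharZero K] (hG : IsSpecialization π G g) (k : ℕ) :
    IsSpecialization π (G ^ k) (g ^ k) := by
  induction k with
  | zero => simpa using IsSpecialization.one π
  | succ k ih => rw [pow_succ, pow_succ]; exact ih.mul hG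

end Arrangements

section Specialization

variable {K : Type*} [Field K]

theorem coeff_exp_var {σ : Type*} [DecidableEq σ] (a : σ) (w : List σ) :
    (exp (var a : NCSeries σ K)).coeff w =
      if w = List.replicate w.length a then 1 / (w.length.factorial : K) else 0 := by
  change ∑ k ∈ Finset.range (w.length + 1), _ = _
  simp only [coeff_var_pow]
  rw [Finset.sum_eq_single w.length]
  · split_ifs <;> simp
  · intro k _ hk
    rw [if_neg, mul_zero]
    intro h
    exact hk (by rw [h, List.length_replicate])
  · simp

theorem pairwise_le_iff_eq_replicate (w : List (Fin 2)) :
    w.Pairwise (· ≤ ·) ↔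
      w = List.replicate (w.count 0) 0 ++ List.replicate (w.count 1) 1 := by
  constructor
  · intro h
    refine List.Perm.eq_of_pairwise' h ?_ ?_
    · rw [List.pairwise_append]
      refine ⟨List.pairwise_replicate.mpr (Or.inr le_rfl),
        List.pairwise_replicate.mpr (Or.inr le_rfl), fun a ha b hb => ?_⟩
      rw [List.eq_of_mem_replicate ha]
      exact Fin.zero_le b
    · rw [List.perm_iff_count]
      intro c
      fin_cases c <;> simp [List.count_replicate]
  · intro h
    rw [h, List.pairwise_append]
    refine ⟨List.pairwise_replicate.mpr (Or.inr le_rfl),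
        List.pairwise_replicate.mpr (Or.inr le_rfl), fun a ha b hb => ?_⟩
    rw [List.eq_of_mem_replicate ha]
    exact Fin.zero_le b

theorem length_eq_count_add_count (w : List (Fin 2)) : w.length = w.count 0 + w.count 1 := by
  induction w with
  | nil => rfl
  | cons a w ih =>
    fin_cases a <;> simp [ih] <;> omega

/-- Only a cut that separates the letters `0` from the letters `1` contributes, so only sorted words
occur, each through a single cut. -/
theorem coeff_expProd (w : List (Fin 2)) :
    (expProd K).coeff w = if w.Pairwise (· ≤ ·) then
      1 / (((w.count 0).factorial : K) * ((w.count 1).factorial : K)) else 0 := by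
  have hlen := length_eq_count_add_count w
  rw [expProd, coeff_mul]
  simp only [coeff_exp_var]
  have hk : ∀ k, w.take k = List.replicate (w.take k).length 0 →
      w.drop k = List.replicate (w.drop k).length 1 →
      w.count 0 = (w.take k).length ∧ w.count 1 = (w.drop k).length := by
    intro k h1 h2
    have h3 : ∀ c, w.count c = (w.take k).count c + (w.drop k).count c := fun c => by
      rw [← List.count_append, List.take_append_drop]
    rw [h3, h3, h1, h2]
    simp [List.count_replicate]
  split_ifs with h
  · have h' := (pairwise_le_iff_eq_replicate w).mp h
    have t1 : w.take (w.count 0) = List.replicate (w.count 0) 0 :=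
      (congrArg (List.take (w.count 0)) h').trans (List.take_left' List.length_replicate)
    have t2 : w.drop (w.count 0) = List.replicate (w.count 1) 1 :=
      (congrArg (List.drop (w.count 0)) h').trans (List.drop_left' List.length_replicate)
    rw [Finset.sum_eq_single (w.count 0)]
    · rw [t1, t2]
      simp [mul_comm]
    · intro k hk' hne
      rw [Finset.mem_range] at hk'
      by_cases h1 : w.take k = List.replicate (w.take k).length 0
      · by_cases h2 : w.drop k = List.replicate (w.drop k).length 1
        · refine absurd ?_ hne
          have := (hk k h1 h2).1
          rw [List.length_take] at this
          omega
        · rw [if_neg h2, mul_zero]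
      · rw [if_neg h1, zero_mul]
    · intro hn
      rw [Finset.mem_range] at hn
      omega
  · refine Finset.sum_eq_zero fun k _ => ?_
    by_cases h1 : w.take k = List.replicate (w.take k).length 0
    · by_cases h2 : w.drop k = List.replicate (w.drop k).length 1
      · refine absurd ((pairwise_le_iff_eq_replicate w).mpr ?_) h
        obtain ⟨e0, e1⟩ := hk k h1 h2
        rw [e0, e1, ← h1, ← h2, List.take_append_drop]
      · rw [if_neg h2, mul_zero]
    · rw [if_neg h1, zero_mul]

variable {α : Type*} [LinearOrder α] [CharZero K]

/-- Among the arrangements of $S$ only the sorted one is increasing. A monotone $\pi$ sends it to a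
sorted word, where $e^Xe^Y$ has coefficient $1/(i!\,j!)$. -/
theorem isSpecialization_increasing {π : α → Fin 2} (hπ : Monotone π) :
    IsSpecialization π (increasing K α) (expProd K) := by
  intro S w
  have hsort : S.sort ∈ arrangements S :=
    mem_arrangements.mpr ⟨S.sort_nodup _, S.sort_toFinset _⟩
  have h1 : arrangementSum π S (increasing K α) w = if (S.sort).map π = w then 1 else 0 := by
    rw [arrangementSum, Finset.sum_filter, Finset.sum_eq_single_of_mem _ hsort]
    · rw [coeff_increasing, if_pos S.sortedLT_sort.pairwise]
    · intro l hl hne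
      rw [mem_arrangements] at hl
      have : ¬ l.Pairwise (· < ·) := by
        intro hl'
        refine hne ?_
        rw [← hl.2]
        exact ((List.toFinset_sort (· ≤ ·) hl.1).mpr (hl'.imp le_of_lt)).symm
      rw [coeff_increasing, if_neg this, ite_self]
  have hcount : ∀ c, ((S.sort).map π).count c = fiberCard π S c := by
    intro c
    rw [fiberCard, ← Multiset.coe_count, ← Multiset.map_coe, S.sort_eq, Multiset.count_map,
      Finset.card, Finset.filter_val]
    simp only [eq_comm]
  have hpw : ((S.sort).map π).Pairwise (· ≤ ·) :=
    List.pairwise_map.mpr ((S.pairwise_sort _).imp fun h => hπ h)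
  rw [h1, coeff_expProd]
  by_cases h : (S.sort).map π = w
  · subst h
    rw [if_pos rfl, if_pos hpw, if_pos (funext fun c => (hcount c).symm), Fin.prod_univ_two,
      hcount, hcount]
    have f1 := Nat.cast_ne_zero (R := K).mpr (fiberCard π S 0).factorial_ne_zero
    have f2 := Nat.cast_ne_zero (R := K).mpr (fiberCard π S 1).factorial_ne_zero
    field_simp
  · rw [if_neg h]
    split_ifs with h2 h3
    · refine absurd (List.Perm.eq_of_pairwise' hpw h3 ?_) h
      rw [List.perm_iff_count]
      intro c
      rw [hcount, h2]
    · rw [mul_zero]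
    · rfl

theorem isSpecialization_truncatedLogDeriv {π : α → Fin 2} (hπ : Monotone π) (n : ℕ) :
    IsSpecialization π (∑ k ∈ Finset.range n, ((-1) ^ k / ((k : K) + 1)) •
      (increasing K α * (increasing K α - 1) ^ k)) (truncatedLogDeriv K n) := by
  have h := isSpecialization_increasing (K := K) hπ
  exact IsSpecialization.sum _ fun k _ => (h.mul ((h.sub (IsSpecialization.one π)).pow k)).smul _

theorem sum_arrangements_univ {n : ℕ} {M : Type*} [AddCommMonoid M] (f : List (Fin n) → M) :
    ∑ l ∈ arrangements (Finset.univ : Finset (Fin n)), f l =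
      ∑ σ : Equiv.Perm (Fin n), f (List.ofFn σ) := by
  symm
  refine Finset.sum_bij (fun σ _ => List.ofFn σ) ?_ ?_ ?_ ?_
  · intro σ _
    rw [mem_arrangements]
    refine ⟨List.nodup_ofFn.mpr σ.injective, Finset.eq_univ_of_forall fun i => ?_⟩
    rw [List.mem_toFinset, List.mem_ofFn]
    exact σ.surjective i
  · intro σ _ τ _ h
    exact DFunLike.coe_injective (List.ofFn_injective h)
  · intro l hl
    rw [mem_arrangements] at hl
    have hlen : l.length = n := by
      rw [← List.toFinset_card_of_nodup hl.1, hl.2, Finset.card_univ, Fintype.card_fin]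
    refine ⟨Equiv.ofBijective (fun i => l.get (i.cast hlen.symm)) ?_, Finset.mem_univ _, ?_⟩
    · exact (Finite.injective_iff_bijective).mp
        ((List.nodup_iff_injective_get.mp hl.1).comp (Fin.cast_injective hlen.symm))
    · exact List.ext_getElem (by simp [hlen]) (by simp)
  · intro σ _
    rfl

/-- The coefficients of `truncatedLogDeriv` as sums over permutations. -/
theorem coeff_truncatedLogDeriv {n N : ℕ} (hn : 0 < n) (hN : n < N) {π : Fin n → Fin 2}
    (hπ : Monotone π) {w : List (Fin 2)} (hw : ∀ c, fiberCard π Finset.univ c = w.count c) :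
    (((w.count 0).factorial : K) * ((w.count 1).factorial : K)) * (truncatedLogDeriv K N).coeff w =
      ∑ σ : Equiv.Perm (Fin n), if List.ofFn (fun k => π (σ k)) = w then
        1 / ((n : K) + 1) * ((-1) ^ numDescents σ / (n.choose (numDescents σ) : K)) else 0 := by
  have h := isSpecialization_truncatedLogDeriv (K := K) hπ N Finset.univ w
  rw [if_pos (funext hw), Fin.prod_univ_two, hw, hw] at h
  rw [← h, arrangementSum, Finset.sum_filter, sum_arrangements_univ]
  refine Finset.sum_congr rfl fun σ _ => ?_
  rw [List.map_ofFn]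
  change (if List.ofFn (fun k => π (σ k)) = w then _ else _) = _
  congr 1
  have hd : descents (List.ofFn σ) = numDescents σ := by
    rw [descents_ofFn, numDescents]
  have hlt : numDescents σ < n := by
    obtain ⟨n, rfl⟩ : ∃ m, n = m + 1 := ⟨n - 1, by omega⟩
    rw [← hd]
    have := descents_lt_length (σ 0) (List.ofFn fun i => σ (Fin.succ i))
    rwa [← List.ofFn_succ, List.length_ofFn] at this
  -- Here `e` is the number of ascents, so the beta value $d!\,(e+1)!/(n+1)!$ is $1/((n+1)\binom
  -- nd)$.
  obtain ⟨e, he⟩ : ∃ e, n = numDescents σ + e + 1 := ⟨n - numDescents σ - 1, by omega⟩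
  rw [coeff_sum_increasing (List.ofFn σ) (List.nodup_ofFn.mpr σ.injective) N (numDescents σ) e
    (by simpa using hN) hd (by simpa using he)]
  generalize numDescents σ = d at *
  subst he
  have hc := Nat.choose_mul_factorial_mul_factorial (show d ≤ d + e + 1 by omega)
  rw [show d + e + 1 - d = e + 1 by omega] at hc
  have hc' : ((d + e + 1).choose d : K) * d.factorial * (e + 1).factorial =
    (d + e + 1).factorial := by exact_mod_cast hc
  have h1 : ((d + e + 1).choose d : K) ≠ 0 :=
    Nat.cast_ne_zero.mpr (Nat.choose_pos (by omega)).ne'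
  have h2 : ((d + e + 1).factorial : K) ≠ 0 := Nat.cast_ne_zero.mpr (Nat.factorial_ne_zero _)
  have h3 : ((d + e + 1 : ℕ) : K) + 1 ≠ 0 := by exact_mod_cast (d + e + 1).succ_ne_zero
  rw [show d + e + 2 = d + e + 1 + 1 by omega, Nat.factorial_succ (d + e + 1), Nat.cast_mul,
    Nat.cast_succ (d + e + 1)]
  rw [one_div_mul_eq_div, div_div, div_eq_div_iff (mul_ne_zero h3 h2) (mul_ne_zero h1 h3), ← hc']
  ring

end Specialization

end NCSeries

/-! ### Enumeration of the sum in degrees two, three and four. -/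

section SmallDegrees

variable {K A : Type*} [Field K] [CharZero K] [AddCommGroup A] [Module K A]

/-- Here and in degrees three and four only equal terms are collected, so `br` may be any binary
operation, with no bilinearity or other law. -/
theorem nestedCommutatorSum_two (br : A → A → A) (x y : A) :
    nestedCommutatorSum K br 2 x y = (1 / 2 : K) • br x y := by
  have h1 : (Finset.HasAntidiagonal.antidiagonal 2).filter
      (fun p : ℕ × ℕ => 1 ≤ p.1 ∧ 1 ≤ p.2) = {(1, 1)} := by decide
  have h2 : (Finset.univ : Finset (Equiv.Perm (Fin (2 - 1)))) = {1} := by decide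
  have d1 : numDescents (1 : Equiv.Perm (Fin (2 - 1))) = 0 := by decide
  rw [nestedCommutatorSum, h1, h2]
  simp [d1, rightNested]

theorem nestedCommutatorSum_three (br : A → A → A) (x y : A) :
    nestedCommutatorSum K br 3 x y = (1 / 12 : K) • br x (br x y) + (1 / 6 : K) • br x (br y y)
      - (1 / 12 : K) • br y (br x y) := by
  have h1 : (Finset.HasAntidiagonal.antidiagonal 3).filter
      (fun p : ℕ × ℕ => 1 ≤ p.1 ∧ 1 ≤ p.2) = {(1, 2), (2, 1)} := by decide
  have h2 : (Finset.univ : Finset (Equiv.Perm (Fin 2))) = {1, Equiv.swap 0 1} := by decide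
  have d1 : numDescents (1 : Equiv.Perm (Fin 2)) = 0 := by decide
  have d2 : numDescents (Equiv.swap 0 1 : Equiv.Perm (Fin 2)) = 1 := by decide
  rw [nestedCommutatorSum, h1]
  simp only [show 3 - 1 = 2 from rfl]
  rw [h2, Finset.sum_pair (by decide), Finset.sum_pair (by decide), Finset.sum_pair (by decide),
    d1, d2]
  simp [rightNested, List.ofFn_succ, Nat.factorial]
  module

theorem nestedCommutatorSum_four (br : A → A → A) (x y : A) :
    nestedCommutatorSum K br 4 x y =
      (1 / 24 : K) • br x (br x (br y y)) - (1 / 24 : K) • br x (br y (br x y))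
        + (1 / 36 : K) • br x (br y (br y y)) - (1 / 36 : K) • br y (br x (br y y)) := by
  have h1 : (Finset.HasAntidiagonal.antidiagonal 4).filter
      (fun p : ℕ × ℕ => 1 ≤ p.1 ∧ 1 ≤ p.2) = {(1, 3), (2, 2), (3, 1)} := by decide
  have h2 : (Finset.univ : Finset (Equiv.Perm (Fin 3))) = {1, Equiv.swap 0 1, Equiv.swap 1 2,
    Equiv.swap 0 2, Equiv.swap 0 1 * Equiv.swap 1 2, Equiv.swap 1 2 * Equiv.swap 0 1} := by decide
  have h3 : ∀ f : Equiv.Perm (Fin 3) → A, ∑ σ, f σ = f 1 + (f (Equiv.swap 0 1) +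
      (f (Equiv.swap 1 2) + (f (Equiv.swap 0 2) + (f (Equiv.swap 0 1 * Equiv.swap 1 2) +
        f (Equiv.swap 1 2 * Equiv.swap 0 1))))) := by
    intro f
    rw [h2, Finset.sum_insert (by decide), Finset.sum_insert (by decide),
      Finset.sum_insert (by decide), Finset.sum_insert (by decide), Finset.sum_pair (by decide)]
  have d1 : numDescents (1 : Equiv.Perm (Fin 3)) = 0 := by decide
  have d2 : numDescents (Equiv.swap 0 1 : Equiv.Perm (Fin 3)) = 1 := by decide
  have d3 : numDescents (Equiv.swap 1 2 : Equiv.Perm (Fin 3)) = 1 := by decide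
  have d4 : numDescents (Equiv.swap 0 2 : Equiv.Perm (Fin 3)) = 2 := by decide
  have d5 : numDescents (Equiv.swap 0 1 * Equiv.swap 1 2 : Equiv.Perm (Fin 3)) = 1 := by decide
  have d6 : numDescents (Equiv.swap 1 2 * Equiv.swap 0 1 : Equiv.Perm (Fin 3)) = 1 := by decide
  have r : ∀ (σ : Equiv.Perm (Fin 3)) (i : ℕ),
      rightNested br (fun k => if (σ k : ℕ) < i then x else y) y =
        br (if (σ 0 : ℕ) < i then x else y) (br (if (σ 1 : ℕ) < i then x else y)
          (br (if (σ 2 : ℕ) < i then x else y) y)) := fun σ i => by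
    simp [rightNested, List.ofFn_succ]
  have v2 : (Equiv.swap 0 1 : Equiv.Perm (Fin 3)) 0 = 1 ∧
    (Equiv.swap 0 1 : Equiv.Perm (Fin 3)) 1 = 0 ∧
    (Equiv.swap 0 1 : Equiv.Perm (Fin 3)) 2 = 2 := by decide
  have v3 : (Equiv.swap 1 2 : Equiv.Perm (Fin 3)) 0 = 0 ∧
    (Equiv.swap 1 2 : Equiv.Perm (Fin 3)) 1 = 2 ∧
    (Equiv.swap 1 2 : Equiv.Perm (Fin 3)) 2 = 1 := by decide
  have v4 : (Equiv.swap 0 2 : Equiv.Perm (Fin 3)) 0 = 2 ∧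
    (Equiv.swap 0 2 : Equiv.Perm (Fin 3)) 1 = 1 ∧
    (Equiv.swap 0 2 : Equiv.Perm (Fin 3)) 2 = 0 := by decide
  rw [nestedCommutatorSum, h1]
  simp only [show 4 - 1 = 3 from rfl]
  rw [Finset.sum_insert (by decide), Finset.sum_pair (by decide), h3, h3, h3, d1, d2, d3, d4, d5,
    d6]
  simp only [r]
  simp only [Equiv.Perm.mul_apply, Equiv.Perm.one_apply, v2, v3, v4]
  simp [Nat.factorial, Nat.choose]
  module

end SmallDegrees

namespace NCSeries

/-! ### Words in $X$ alone. -/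

section SingleLetter

variable {σ K : Type*} [Field K]

/-- The coefficients of the powers of one variable, as a power series in one variable. -/
noncomputable def restrictLetter (a : σ) (f : NCSeries σ K) : PowerSeries K :=
  PowerSeries.mk fun n => f.coeff (List.replicate n a)

theorem coeff_restrictLetter (a : σ) (f : NCSeries σ K) (n : ℕ) :
    PowerSeries.coeff n (restrictLetter a f) = f.coeff (List.replicate n a) :=
  PowerSeries.coeff_mk _ _

/-- `restrictLetter` as a ring homomorphism. -/
noncomputable def restrictLetterHom (a : σ) : NCSeries σ K →+* PowerSeries K where
  toFun := restrictLetter a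
  map_one' := by
    ext n
    rw [coeff_restrictLetter, PowerSeries.coeff_one]
    cases n <;> simp [List.replicate_succ]
  map_mul' f g := by
    ext n
    rw [coeff_restrictLetter, PowerSeries.coeff_mul,
      Finset.Nat.sum_antidiagonal_eq_sum_range_succ_mk, coeff_mul, List.length_replicate]
    refine Finset.sum_congr rfl fun k hk => ?_
    rw [Finset.mem_range] at hk
    rw [coeff_restrictLetter, coeff_restrictLetter, List.take_replicate, List.drop_replicate,
      min_eq_left (by omega)]
  map_zero' := by
    ext n
    rw [coeff_restrictLetter, coeff_zero, map_zero]
  map_add' f g := by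
    ext n
    rw [map_add, coeff_restrictLetter, coeff_restrictLetter, coeff_restrictLetter, coeff_add]

theorem restrictLetterHom_smul (a : σ) (c : K) (f : NCSeries σ K) :
    restrictLetterHom a (c • f) = c • restrictLetterHom a f := by
  ext n
  change PowerSeries.coeff n (restrictLetter a (c • f)) =
    PowerSeries.coeff n (c • restrictLetter a f)
  rw [PowerSeries.coeff_smul, coeff_restrictLetter, coeff_restrictLetter, coeff_smul, smul_eq_mul]

theorem restrictLetterHom_var [DecidableEq σ] (a : σ) :
    restrictLetterHom a (var a : NCSeries σ K) = PowerSeries.X := by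
  ext n
  change PowerSeries.coeff n (restrictLetter a (var a)) = _
  rw [coeff_restrictLetter, PowerSeries.coeff_X, coeff_var]
  congr 1
  rw [eq_iff_iff]
  constructor
  · intro h
    simpa using congrArg List.length h
  · rintro rfl
    rfl

/-- Restricted to powers of $X$, series commute. The derivation counting $X$ sends $\log W$ to a
geometric series in $-T$ times $(1+T)X$, hence to $X$, which has no coefficient in degree $m\ge2$.
-/
theorem coeff_bchSeries_replicate_zero [CharZero K] {m : ℕ} (hm : 2 ≤ m) :
    (bchSeries K).coeff (List.replicate m 0) = 0 := by
  have h1 := letterDeriv_mem_orderGE 0 (bchSeries_sub_sum_mem (K := K) (m + 1))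
    (List.replicate m 0) (by simp)
  rw [map_sub, map_sum, coeff_sub, sub_eq_zero, coeff_letterDeriv, List.count_replicate_self,
    ← coeff_restrictLetter] at h1
  have h2 : restrictLetterHom (0 : Fin 2) (∑ k ∈ Finset.range (m + 1), letterDeriv 0
      (((-1) ^ k / ((k : K) + 1)) • (expProd K - 1) ^ (k + 1))) =
      (1 - (-restrictLetterHom 0 (expProd K - 1)) ^ (m + 1)) * PowerSeries.X := by
    have e0 : restrictLetterHom 0 (letterDeriv 0 (expProd K)) =
        (1 + restrictLetterHom 0 (expProd K - 1)) * PowerSeries.X := by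
      rw [map_sub, map_one, add_sub_cancel, expProd, letterDeriv_mul, letterDeriv_exp_var,
        letterDeriv_exp_var_of_ne (by decide), mul_zero, add_zero, map_mul, map_mul, map_mul,
        restrictLetterHom_var]
      ring
    have e1 := mul_neg_geom_sum (-restrictLetterHom (0 : Fin 2) (expProd K - 1)) (m + 1)
    rw [sub_neg_eq_add] at e1
    rw [← e1, mul_right_comm, ← e0, map_sum, Finset.mul_sum]
    refine Finset.sum_congr rfl fun k _ => ?_
    have hk : (k : K) + 1 ≠ 0 := by exact_mod_cast k.succ_ne_zero
    have e2 : ∀ i ∈ Finset.range (k + 1), restrictLetterHom (0 : Fin 2)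
        ((expProd K - 1) ^ i * letterDeriv 0 (expProd K) * (expProd K - 1) ^ (k - i)) =
        restrictLetterHom 0 (letterDeriv 0 (expProd K)) *
          restrictLetterHom 0 (expProd K - 1) ^ k := by
      intro i hi
      rw [Finset.mem_range] at hi
      obtain ⟨j, rfl⟩ : ∃ j, k = i + j := ⟨k - i, by omega⟩
      rw [Nat.add_sub_cancel_left, map_mul, map_mul, map_pow, map_pow, pow_add]
      ring
    rw [map_smul, restrictLetterHom_smul, letterDeriv_pow_succ, map_sub, letterDeriv_one, sub_zero,
      map_sum, Finset.sum_congr rfl e2, Finset.sum_const, Finset.card_range,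
      ← Nat.cast_smul_eq_nsmul K, smul_smul, Nat.cast_succ, div_mul_cancel₀ _ hk]
    generalize restrictLetterHom (0 : Fin 2) (expProd K - 1) = T
    rw [neg_pow T]
    rcases Nat.even_or_odd k with h | h <;> simp [h.neg_one_pow]
  have h3 := congrArg (PowerSeries.coeff m) h2
  obtain ⟨m, rfl⟩ : ∃ j, m = j + 1 := ⟨m - 1, by omega⟩
  have h4 : PowerSeries.X ∣ restrictLetterHom (0 : Fin 2) (expProd K - 1) := by
    rw [PowerSeries.X_dvd_iff, ← PowerSeries.coeff_zero_eq_constantCoeff_apply]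
    exact (coeff_restrictLetter 0 (expProd K - 1) 0).trans
      (mem_orderGE_one.mp expProd_sub_one_mem)
  have h5 := PowerSeries.X_pow_dvd_iff.mp
    (pow_dvd_pow_of_dvd ((dvd_neg).mpr h4) (m + 1 + 1)) m (by omega)
  rw [PowerSeries.coeff_succ_mul_X, map_sub, h5, PowerSeries.coeff_one, if_neg (by omega),
    sub_zero] at h3
  have h6 := h1.trans ((coeff_restrictLetter 0 _ _).symm.trans h3)
  rw [coeff_restrictLetter] at h6
  exact (mul_eq_zero.mp h6).resolve_left (Nat.cast_ne_zero.mpr m.succ_ne_zero)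

end SingleLetter

/-! ### Multihomogeneity of nested brackets. -/

section Rearrangement

variable {σ K : Type*} [Field K]

/-- Only rearrangements of the word `w` occur in `f`. -/
def SupportedOnPerms (f : NCSeries σ K) (w : List σ) : Prop :=
  ∀ v, f.coeff v ≠ 0 → v.Perm w

theorem SupportedOnPerms.var [DecidableEq σ] (a : σ) :
    SupportedOnPerms (var a : NCSeries σ K) [a] := by
  intro v hv
  rw [coeff_var] at hv
  have h : v = [a] := by_contra fun h => hv (if_neg h)
  rw [h]

theorem SupportedOnPerms.mul {f g : NCSeries σ K} {u w : List σ} (hf : SupportedOnPerms f u)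
    (hg : SupportedOnPerms g w) : SupportedOnPerms (f * g) (u ++ w) := by
  intro v hv
  rw [coeff_mul] at hv
  obtain ⟨k, -, hk⟩ := Finset.exists_ne_zero_of_sum_ne_zero hv
  rw [← List.take_append_drop k v]
  exact (hf _ (left_ne_zero_of_mul hk)).append (hg _ (right_ne_zero_of_mul hk))

theorem SupportedOnPerms.lie {f g : NCSeries σ K} {u w : List σ} (hf : SupportedOnPerms f u)
    (hg : SupportedOnPerms g w) : SupportedOnPerms ⁅f, g⁆ (u ++ w) := by
  intro v hv
  rw [Ring.lie_def, coeff_sub] at hv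
  by_cases h : (f * g).coeff v = 0
  · refine (hg.mul hf v fun h' => hv ?_).trans List.perm_append_comm
    rw [h, h', sub_zero]
  · exact hf.mul hg v h

theorem supportedOnPerms_rightNested [DecidableEq σ] {n : ℕ} (u : Fin n → σ) (b : σ) :
    SupportedOnPerms (rightNested (fun f g => ⁅f, g⁆)
      (fun k => (NCSeries.var (u k) : NCSeries σ K)) (NCSeries.var b)) (List.ofFn u ++ [b]) := by
  have h : List.ofFn (fun k => (NCSeries.var (u k) : NCSeries σ K)) =
    (List.ofFn u).map NCSeries.var := by rw [List.map_ofFn]; rfl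
  rw [rightNested, h]
  induction List.ofFn u with
  | nil => exact SupportedOnPerms.var b
  | cons a l ih => exact (SupportedOnPerms.var a).lie ih

end Rearrangement

/-! ### Comparison of coefficients and the main theorem. -/

section Main

variable {K : Type*} [Field K]

theorem count_ofFn_comp_perm {n : ℕ} {β : Type*} [DecidableEq β] (π : Fin n → β)
    (τ : Equiv.Perm (Fin n)) (c : β) :
    (List.ofFn fun k => π (τ k)).count c = fiberCard π Finset.univ c := by
  rw [List.ofFn_eq_map, ← Multiset.coe_count, ← Multiset.map_coe,
    show ((List.finRange n : List (Fin n)) : Multiset (Fin n)) = Finset.univ.val from rfl,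
    Multiset.count_map, fiberCard]
  change (Finset.univ.filter fun k => c = π (τ k)).card = _
  refine Finset.card_equiv τ fun k => ?_
  simp [eq_comm]

/-- The letters `X, …, X, Y, …, Y`, where `X` occurs `i` times. -/
def block (i n : ℕ) (k : Fin n) : Fin 2 := if (k : ℕ) < i then 0 else 1

theorem monotone_block (i n : ℕ) : Monotone (block i n) := by
  intro a b hab
  rw [block, block]
  split_ifs with h1 h2
  · exact le_rfl
  · exact Fin.zero_le _
  · exact absurd (lt_of_le_of_lt (Fin.le_def.mp hab) ‹_›) h1
  · exact le_rfl

theorem fiberCard_block_zero {i n : ℕ} (h : i ≤ n) :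
    fiberCard (block i n) Finset.univ 0 = i := by
  have : ∀ k : Fin n, block i n k = 0 ↔ (k : ℕ) < i := fun k => by
    rw [block]
    split_ifs with h <;> simp [h]
  simp only [fiberCard, this]
  rw [Fin.card_filter_val_lt, min_eq_right h]

theorem fiberCard_block_one {i n : ℕ} (h : i ≤ n) :
    fiberCard (block i n) Finset.univ 1 = n - i := by
  have h0 := fiberCard_block_zero h
  have h1 := length_eq_count_add_count (List.ofFn fun k => block i n ((1 : Equiv.Perm (Fin n)) k))
  rw [count_ofFn_comp_perm, count_ofFn_comp_perm, List.length_ofFn, h0] at h1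
  omega

variable (K) in
/-- The bracket `[Z₁, [Z₂, …, [Zₙ, Y] … ]]` for the letters `Zₖ` given by `u`. -/
noncomputable def nestedLetters {n : ℕ} (u : Fin n → Fin 2) : NCSeries (Fin 2) K :=
  rightNested (fun f g => ⁅f, g⁆) (fun k => (var (u k) : NCSeries (Fin 2) K)) (var 1)

theorem nestedLetters_coeff_ne_zero {n : ℕ} {u : Fin n → Fin 2} {v : List (Fin 2)}
    (h : (nestedLetters K u).coeff v ≠ 0) : v.length = n + 1 ∧
      v.count 0 = (List.ofFn u).count 0 ∧ v.count 1 = (List.ofFn u).count 1 + 1 := by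
  have hp := supportedOnPerms_rightNested u 1 v h
  refine ⟨by simpa using hp.length_eq, ?_, ?_⟩
  · rw [hp.count_eq]
    simp
  · rw [hp.count_eq]
    simp

theorem nestedLetters_const_one {n : ℕ} (hn : 0 < n) :
    nestedLetters K (fun _ : Fin n => 1) = 0 := by
  have h : ∀ n, nestedLetters K (fun _ : Fin (n + 1) => 1) = 0 := by
    intro n
    induction n with
    | zero => simp [nestedLetters, rightNested, Ring.lie_def]
    | succ n ih =>
      have : nestedLetters K (fun _ : Fin (n + 1 + 1) => 1) =
          ⁅(var 1 : NCSeries (Fin 2) K), nestedLetters K (fun _ : Fin (n + 1) => 1)⁆ := by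
        rw [nestedLetters, rightNested, List.ofFn_succ]
        rfl
      rw [this, ih, lie_eq_ad, map_zero]
  obtain ⟨m, rfl⟩ : ∃ m, n = m + 1 := ⟨n - 1, by omega⟩
  exact h m

variable (K) in
/-- The weighted sum over permutations in the formula for the Baker-Campbell-Hausdorff series. -/
noncomputable def permSum (i n : ℕ) : NCSeries (Fin 2) K :=
  ∑ τ : Equiv.Perm (Fin n), ((-1 : K) ^ numDescents τ / (n.choose (numDescents τ) : K)) •
    nestedLetters K (fun k => block i n (τ k))

theorem nestedCommutatorSum_eq (n : ℕ) :
    nestedCommutatorSum K (fun a b : NCSeries (Fin 2) K => ⁅a, b⁆) (n + 1) (var 0) (var 1) =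
      ∑ p ∈ (Finset.HasAntidiagonal.antidiagonal (n + 1)).filter
          (fun p : ℕ × ℕ => 1 ≤ p.1 ∧ 1 ≤ p.2),
        (1 / (p.1.factorial : K) * (1 / (p.2.factorial : K)) * (1 / ((n : K) + 1))) •
          permSum K p.1 n := by
  rw [nestedCommutatorSum]
  refine Finset.sum_congr rfl fun p _ => ?_
  rw [Nat.cast_succ]
  congr 1
  refine Finset.sum_congr rfl fun τ _ => ?_
  have : ∀ k, (if (τ k : ℕ) < p.1 then var 0 else var 1 : NCSeries (Fin 2) K) =
      var (block p.1 n (τ k)) := fun k => by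
    rw [block]
    split_ifs <;> rfl
  exact congrArg _ (congrArg (fun a => rightNested (fun f g => ⁅f, g⁆) a (var 1)) (funext this))

theorem permSum_coeff_eq_zero {i n : ℕ} (hi : i ≤ n) {v : List (Fin 2)}
    (h : ¬ (v.length = n + 1 ∧ v.count 0 = i)) : (permSum K i n).coeff v = 0 := by
  rw [permSum, coeff_sum]
  refine Finset.sum_eq_zero fun τ _ => ?_
  rw [coeff_smul]
  refine mul_eq_zero_of_right _ ?_
  by_contra h'
  obtain ⟨h1, h2, -⟩ := nestedLetters_coeff_ne_zero h'
  rw [count_ofFn_comp_perm, fiberCard_block_zero hi] at h2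
  exact h ⟨h1, h2⟩

theorem permSum_zero {n : ℕ} (hn : 0 < n) : permSum K 0 n = 0 := by
  refine Finset.sum_eq_zero fun τ _ => ?_
  have : (fun k => block 0 n (τ k)) = fun _ => 1 := funext fun k => if_neg (Nat.not_lt_zero _)
  rw [this, nestedLetters_const_one hn, smul_zero]

variable [CharZero K]

theorem count_mul_coeff_bchSeries {n : ℕ} {v : List (Fin 2)} (hv : v.length = n + 1) (N : ℕ)
    (hN : n + 1 < N) : (v.count 1 : K) * (bchSeries K).coeff v =
      ∑ u : Fin n → Fin 2, (truncatedLogDeriv K N).coeff (List.ofFn u) *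
        (nestedLetters K u).coeff v := by
  have h1 := coeff_eq_of_sub_mem (letterDeriv_bchSeries_sub_mem (K := K) N) (w := v) (by omega)
  have h2 : ∀ k, (adSum k (truncatedLogDeriv K N) (var 1)).coeff v =
      ∑ u : Fin k → Fin 2, (truncatedLogDeriv K N).coeff (List.ofFn u) *
        (nestedLetters K u).coeff v := by
    intro k
    rw [adSum_eq_sum, coeff_sum]
    rfl
  rw [coeff_letterDeriv, coeff_adAct, Finset.sum_eq_single n, h2] at h1
  · exact h1
  · intro k _ hk
    rw [h2]
    refine Finset.sum_eq_zero fun u _ => mul_eq_zero_of_right _ ?_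
    by_contra h
    have := (nestedLetters_coeff_ne_zero h).1
    omega
  · intro h
    rw [Finset.mem_range] at h
    omega

/-- The innermost $Y$ is not a letter of the acting word, which therefore has $i$ letters $X$ and
$j$ letters $Y$ and brings $1/(i!\,j!)$. Dividing by the $j+1$ counted by the derivation gives
$1/(i!\,(j+1)!)$. -/
theorem coeff_bchSeries_eq {n i j : ℕ} (hn : 0 < n) (hij : i + j = n) {v : List (Fin 2)}
    (hi : v.count 0 = i) (hj : v.count 1 = j + 1) :
    (bchSeries K).coeff v = 1 / (i.factorial : K) * (1 / ((j + 1).factorial : K)) *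
      (1 / ((n : K) + 1)) * (permSum K i n).coeff v := by
  have hv : v.length = n + 1 := by
    rw [length_eq_count_add_count]
    omega
  have h1 := count_mul_coeff_bchSeries (K := K) hv (n + 2) (by omega)
  have hi' : fiberCard (block i n) Finset.univ 0 = i := fiberCard_block_zero (by omega)
  have hj' : fiberCard (block i n) Finset.univ 1 = j := by
    rw [fiberCard_block_one (by omega)]
    omega
  have h2 : ∀ u : Fin n → Fin 2, (i.factorial : K) * j.factorial *
      ((truncatedLogDeriv K (n + 2)).coeff (List.ofFn u) * (nestedLetters K u).coeff v) =
      ∑ τ : Equiv.Perm (Fin n), if (fun k => block i n (τ k)) = u then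
        1 / ((n : K) + 1) * ((-1) ^ numDescents τ / (n.choose (numDescents τ) : K)) *
          (nestedLetters K u).coeff v else 0 := by
    intro u
    -- The coefficient formula needs `u` to have the letter counts of the block; a bracket that
    -- contributes to `v` guarantees this.
    by_cases h : (nestedLetters K u).coeff v = 0
    · simp [h]
    · obtain ⟨-, c0, c1⟩ := nestedLetters_coeff_ne_zero h
      have c0' : (List.ofFn u).count 0 = i := by omega
      have c1' : (List.ofFn u).count 1 = j := by omega
      have h3 := coeff_truncatedLogDeriv (K := K) hn (by omega : n < n + 2) (monotone_block i n)
        (w := List.ofFn u) (fun c => by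
          fin_cases c
          · exact hi'.trans c0'.symm
          · exact hj'.trans c1'.symm)
      rw [c0', c1'] at h3
      rw [← mul_assoc, h3, Finset.sum_mul]
      refine Finset.sum_congr rfl fun τ _ => ?_
      simp only [List.ofFn_injective.eq_iff, ite_mul, zero_mul]
  have h3 : (i.factorial : K) * j.factorial * (((j + 1 : ℕ) : K) * (bchSeries K).coeff v) =
      1 / ((n : K) + 1) * (permSum K i n).coeff v := by
    rw [← hj, h1, Finset.mul_sum, Finset.sum_congr rfl fun u _ => h2 u, Finset.sum_comm, permSum,
      coeff_sum, Finset.mul_sum]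
    refine Finset.sum_congr rfl fun τ _ => ?_
    rw [Finset.sum_ite_eq, if_pos (Finset.mem_univ _), coeff_smul, mul_assoc]
  have f1 : (i.factorial : K) ≠ 0 := Nat.cast_ne_zero.mpr i.factorial_ne_zero
  have f2 : ((j + 1).factorial : K) ≠ 0 := Nat.cast_ne_zero.mpr (j + 1).factorial_ne_zero
  have f3 : ((j + 1).factorial : K) = j.factorial * ((j + 1 : ℕ) : K) := by
    rw [Nat.factorial_succ, Nat.cast_mul, mul_comm]
  rw [mul_assoc, ← h3]
  rw [div_mul_div_comm, one_mul, one_div_mul_eq_div, eq_div_iff (mul_ne_zero f1 f2), f3]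
  ring

theorem bchTerm_eq_nestedCommutatorSum {m : ℕ} (hm : 2 ≤ m) :
    bchTerm K m = nestedCommutatorSum K (fun a b : NCSeries (Fin 2) K => ⁅a, b⁆) m
      (var 0) (var 1) := by
  obtain ⟨n, rfl⟩ : ∃ n, m = n + 1 := ⟨m - 1, by omega⟩
  have hn : 0 < n := by omega
  rw [nestedCommutatorSum_eq]
  ext v
  rw [coeff_sum]
  change (if v.length = n + 1 then (bchSeries K).coeff v else 0) = _
  by_cases hv : v.length = n + 1
  · rw [if_pos hv]
    have hcount := length_eq_count_add_count v
    have hother : ∀ p ∈ (Finset.HasAntidiagonal.antidiagonal (n + 1)).filter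
        (fun p : ℕ × ℕ => 1 ≤ p.1 ∧ 1 ≤ p.2), p ≠ (v.count 0, v.count 1) →
        ((1 / (p.1.factorial : K) * (1 / (p.2.factorial : K)) * (1 / ((n : K) + 1))) •
          permSum K p.1 n).coeff v = 0 := by
      intro p hp hne
      rw [Finset.mem_filter, Finset.HasAntidiagonal.mem_antidiagonal] at hp
      rw [coeff_smul, permSum_coeff_eq_zero (by omega), mul_zero]
      rintro ⟨-, h0⟩
      exact hne (Prod.ext (by omega) (by simp only; omega))
    -- Multihomogeneity leaves only the pair of letter counts of `v`, which is excluded from the sum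
    -- when one count is zero. For words without $Y$ the derivation gives no information; for words
    -- without $X$ the factor $[Y,Y]$ makes both sides vanish.
    rcases hj : v.count 1 with _ | j
    · rw [Finset.sum_eq_zero]
      · have hrep : v = List.replicate (n + 1) 0 := by
          rw [List.eq_replicate_iff]
          refine ⟨hv, fun b hb => ?_⟩
          by_contra hb0
          rw [Fin.eq_one_of_ne_zero b hb0, ← List.count_pos_iff] at hb
          omega
        rw [hrep, coeff_bchSeries_replicate_zero hm]
      · intro p hp
        refine hother p hp ?_
        rintro rfl
        rw [Finset.mem_filter] at hp
        have := hp.2.2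
        simp only at this
        omega
    · have h1 := coeff_bchSeries_eq (K := K) hn (by omega : v.count 0 + j = n) rfl hj
      rcases Nat.eq_zero_or_pos (v.count 0) with h0 | h0
      · rw [h1, h0, permSum_zero hn, coeff_zero, mul_zero, Finset.sum_eq_zero]
        intro p hp
        refine hother p hp ?_
        rintro rfl
        rw [Finset.mem_filter] at hp
        have := hp.2.1
        simp only at this
        omega
      · rw [Finset.sum_eq_single (v.count 0, v.count 1) hother, coeff_smul, h1, hj]
        intro h
        refine absurd ?_ h
        rw [Finset.mem_filter, Finset.HasAntidiagonal.mem_antidiagonal]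
        refine ⟨?_, h0, ?_⟩ <;> simp only <;> omega
  · rw [if_neg hv]
    symm
    refine Finset.sum_eq_zero fun p hp => ?_
    rw [Finset.mem_filter, Finset.HasAntidiagonal.mem_antidiagonal] at hp
    rw [coeff_smul, permSum_coeff_eq_zero (by omega) (fun h => hv h.1), mul_zero]

end Main

end NCSeries

theorem mainTheorem2 (K : Type*) [Field K] [CharZero K] :
    -- the general formula in `K⟨⟨X, Y⟩⟩`, with commutators `⁅a, b⁆ = a * b - b * a`
    (∀ m : ℕ, 2 ≤ m →
      bchTerm K m =
        nestedCommutatorSum K (fun a b : NCSeries (Fin 2) K => ⁅a, b⁆) m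
          (NCSeries.var 0) (NCSeries.var 1)) ∧
    -- its expansion for `m = 2, 3, 4`, for a formal bilinear bracket, written as a product, that
    -- satisfies no identities
    (∀ x y : FreeNonUnitalNonAssocAlgebra K (Fin 2),
      x = FreeNonUnitalNonAssocAlgebra.of K 0 → y = FreeNonUnitalNonAssocAlgebra.of K 1 →
      nestedCommutatorSum K (fun a b => a * b) 2 x y = (1 / 2 : K) • (x * y) ∧
      nestedCommutatorSum K (fun a b => a * b) 3 x y =
        (1 / 12 : K) • (x * (x * y)) + (1 / 6 : K) • (x * (y * y))
          - (1 / 12 : K) • (y * (x * y)) ∧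
      nestedCommutatorSum K (fun a b => a * b) 4 x y =
        (1 / 24 : K) • (x * (x * (y * y))) - (1 / 24 : K) • (x * (y * (x * y)))
          + (1 / 36 : K) • (x * (y * (y * y))) - (1 / 36 : K) • (y * (x * (y * y)))) ∧
    -- what remains for `m = 2, 3, 4` when the terms that contain `⁅Y, Y⁆ = 0` are dropped
    (∀ X Y : NCSeries (Fin 2) K, X = NCSeries.var 0 → Y = NCSeries.var 1 →
      bchTerm K 2 = (1 / 2 : K) • ⁅X, Y⁆ ∧
      bchTerm K 3 = (1 / 12 : K) • ⁅X, ⁅X, Y⁆⁆ - (1 / 12 : K) • ⁅Y, ⁅X, Y⁆⁆ ∧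
      bchTerm K 4 = -((1 / 24 : K) • ⁅X, ⁅Y, ⁅X, Y⁆⁆⁆)) := by

  refine ⟨fun m hm => NCSeries.bchTerm_eq_nestedCommutatorSum hm, fun x y _ _ =>
    ⟨nestedCommutatorSum_two _ x y, nestedCommutatorSum_three _ x y,
      nestedCommutatorSum_four _ x y⟩, ?_⟩
  rintro X Y rfl rfl
  have h0 : ⁅(NCSeries.var 1 : NCSeries (Fin 2) K), (NCSeries.var 1 : NCSeries (Fin 2) K)⁆ = 0 :=
    sub_self _
  have h1 : ∀ f : NCSeries (Fin 2) K, ⁅f, (0 : NCSeries (Fin 2) K)⁆ = 0 := fun f => by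
    rw [NCSeries.lie_eq_ad, map_zero]
  refine ⟨?_, ?_, ?_⟩
  · rw [NCSeries.bchTerm_eq_nestedCommutatorSum le_rfl, nestedCommutatorSum_two]
  · rw [NCSeries.bchTerm_eq_nestedCommutatorSum (by norm_num), nestedCommutatorSum_three]
    simp only [h0, h1, smul_zero, add_zero]
  · rw [NCSeries.bchTerm_eq_nestedCommutatorSum (by norm_num), nestedCommutatorSum_four]
    simp only [h0, h1, smul_zero, add_zero, sub_zero, zero_sub]
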